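/- For a finite set $V$ and $P\subseteq[0,1]^V$, let $\operatorname{cone}(P)=\{(\lambda,\lambda x):\lambda\ge 0,\ x\in P\}\subseteq\mathbb{R}^{\{0\}\cup V}$ and let $P_I$ be the convex hull of $P\cap\{0,1\}^V$. Let $\mathrm{LS}_+(P)$ be the set of all $x\in\mathbb{R}^V$ for which there is a real symmetric positive semidefinite matrix $Y$ with rows and columns indexed by $\{0\}\cup V$ such that $Ye_0=\operatorname{diag}(Y)=\binom{1}{x}$ and $Ye_i,\ Y(e_0-e_i)\in\operatorname{cone}(P)$ for all $i\in V$. The $\mathrm{LS}_+$-rank $r_+(G)$ of a finite simple graph $G=(V,E)$ is the least integer $k\ge 0$ such that applying $\mathrm{LS}_+$ $k$ times to $P=\{x\in[0,1]^V: x_i+x_j\le 1\ \text{for all}\ \{i,j\}\in E\}$ gives $P_I$. For a positive integer $\ell$, the graph $G$ is called $\ell$-minimal if $r_+(G)=\ell$ and $|V|=3\ell$. For an integer $k\ge 3$ and $S\subseteq\{4,\dots,k\}$, let $\mathcal{A}_{k,S}$ be the graph with vertex set $\{1,2,3\}\cup\{i_0,i_1,i_2:4\le i\le k\}$ and the following edges: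 $\{1,2\},\{1,3\},\{2,3\}$; $\{i_0,i_1\},\{i_0,i_2\},\{i_1,2\},\{i_1,3\},\{i_2,1\}$ for $4\le i\le k$; $\{i_2,j_1\}$ for $4\le i<j\le k$; and $\{i_2,2\}$ for $i\in S$. **Theorem.** For every positive integer $\ell$ there are at least $2^{\ell-1}$ pairwise non-isomorphic $\ell$-minimal graphs. More precisely, with $k=\ell+2$: for every $S\subseteq\{4,\dots,k\}$ the graph $\mathcal{A}_{k,S}$ is $\ell$-minimal, and for distinct $S,S'\subseteq\{4,\dots,k\}$ the graphs $\mathcal{A}_{k,S}$ and $\mathcal{A}_{k,S'}$ have different degree sequences (multisets of vertex degrees) and so are not isomorphic. -/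

import Mathlib

/-! ### The Lovász–Schrijver operator `LS₊` -/

section LovaszSchrijver

variable {V : Type*}

/-- The homogenized cone `{(t, t x) : t ≥ 0, x ∈ P}` of `P ⊆ ℝ^V`; the homogenizing coordinate
(usually called `0`) is `none : Option V`. -/
def homogenizedCone (P : Set (V → ℝ)) : Set (Option V → ℝ) :=
  {y | ∃ t : ℝ, 0 ≤ t ∧ ∃ x ∈ P, y none = t ∧ ∀ i, y (some i) = t * x i}

/-- The integer hull: the convex hull of the `0/1` points of `P`. -/
def integerHull (P : Set (V → ℝ)) : Set (V → ℝ) :=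
  convexHull ℝ (P ∩ {x | ∀ i, x i = 0 ∨ x i = 1})

/-- The lifted set: the real symmetric positive semidefinite matrices `Y` with `Y e₀ = diag Y`, and
`Y eᵢ` and `Y (e₀ - eᵢ)` in the homogenized cone of `P` for all `i` (`Y.col j` is `Y eⱼ`). -/
def lsPlusLift (P : Set (V → ℝ)) : Set (Matrix (Option V) (Option V) ℝ) :=
  {Y | Y.PosSemidef ∧ Y.col none = Y.diag ∧
    ∀ i : V, Y.col (some i) ∈ homogenizedCone P ∧
      Y.col none - Y.col (some i) ∈ homogenizedCone P}

/-- `LS₊(P)`: the points `x` with `Y e₀ = (1, x)` for some `Y` in the lifted set. -/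
def lsPlus (P : Set (V → ℝ)) : Set (V → ℝ) :=
  {x | ∃ Y ∈ lsPlusLift P, Y.col none none = 1 ∧ ∀ i, Y.col none (some i) = x i}

/-- `r` is the `LS₊`-rank of `P`: the least `k` such that `k` applications of `LS₊` to `P` give the
integer hull of `P`. -/
def IsLSPlusRank (P : Set (V → ℝ)) (r : ℕ) : Prop :=
  IsLeast {k : ℕ | lsPlus^[k] P = integerHull P} r

/-- The fractional stable set polytope of a graph. -/
def fracPolytope (G : SimpleGraph V) : Set (V → ℝ) :=
  {x | (∀ i, 0 ≤ x i ∧ x i ≤ 1) ∧ ∀ i j, G.Adj i j → x i + x j ≤ 1}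

/-- A (finite) graph is `ℓ`-minimal if it has `LS₊`-rank `ℓ` and exactly `3ℓ` vertices. -/
def IsLMinimal [Fintype V] (ℓ : ℕ) (G : SimpleGraph V) : Prop :=
  IsLSPlusRank (fracPolytope G) ℓ ∧ Fintype.card V = 3 * ℓ

open Classical in
/-- The degree sequence of a finite graph: the multiset of its vertex degrees. -/
noncomputable def degreeMultiset [Fintype V] (G : SimpleGraph V) : Multiset ℕ :=
  (Finset.univ : Finset V).val.map fun v => G.degree v

end LovaszSchrijver

/-! ### The graphs `A_k` and `A_{k,S}` -/

/-- The vertices `1, 2, 3` (left summand), and `i₀, i₁, i₂` for `4 ≤ i ≤ k`: the vertex `i_s` is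
`Sum.inr (i, s)`. -/
abbrev AVertex (k : ℕ) : Type := Finset.Icc (1 : ℕ) 3 ⊕ (Finset.Icc (4 : ℕ) k × Fin 3)

/-- The edges of `A_k`, each listed in at least one direction. -/
def aEdge (k : ℕ) : AVertex k → AVertex k → Prop
  | .inl a, .inl b => a ≠ b
  | .inr (_, s), .inl a =>
      (s = 1 ∧ (a : ℕ) = 2) ∨ (s = 1 ∧ (a : ℕ) = 3) ∨ (s = 2 ∧ (a : ℕ) = 1)
  | .inr (i, s), .inr (j, t) =>
      (i = j ∧ s = 0 ∧ (t = 1 ∨ t = 2)) ∨ ((i : ℕ) < j ∧ s = 2 ∧ t = 1)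
  | .inl _, .inr _ => False

/-- The graph `A_k`. -/
def aGraph (k : ℕ) : SimpleGraph (AVertex k) := SimpleGraph.fromRel (aEdge k)

/-- The additional edges `{i₂, 2}`, `i ∈ S`. -/
def aExtraEdge (k : ℕ) (S : Finset ℕ) : AVertex k → AVertex k → Prop
  | .inr (i, s), .inl a => (i : ℕ) ∈ S ∧ s = 2 ∧ (a : ℕ) = 2
  | _, _ => False

/-- The graph `A_{k,S}`: the graph `A_k` together with the edges `{i₂, 2}`, `i ∈ S`. -/
def aGraphS (k : ℕ) (S : Finset ℕ) : SimpleGraph (AVertex k) :=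
  aGraph k ⊔ SimpleGraph.fromRel (aExtraEdge k S)

/-! ### Basic properties of `LS₊` -/

section Cone

variable {V : Type*} {P Q : Set (V → ℝ)}

/-! Upper bound: the rank is at most |V|/3, by induction on |V|. A vertex of degree at most one can
be deleted. If all degrees are at least two, fixing x_v = 1 forces the neighbours of v to 0 and
leaves at most |V| - 3 free vertices; once all these faces are integral, one application of LS₊
finishes, by positive semidefiniteness (`lsPlus_subset_integerHull`).

Lower bound: more edges shrink the fractional polytope and the integer hull. So it suffices to find,
after k - 3 applications of LS₊ to the polytope with all extra edges, a point violating ∑ x_v ≤ k -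
2, an inequality valid already for the stable sets of A_k. Such a point is found infinitesimally.
Let F be the set of tight homogenized stable sets and y the stable set of all i₀, whose excess is
-1. If c + y lies in span F, then c has excess 1, so c in the cone gives a violation.
`exists_mem_homogenizedCone_lsPlus` carries such a c through one application of LS₊, using the
matrix ∑ uuᵀ + ε(xxᵀ - g yyᵀ) over u in F, provided that -y was already available on the relevant
faces of F. These faces are reached by induction on the number of stretched vertices still in play:
on the face where a triangle vertex t vanishes, a stretched vertex m takes over the role of t
(`collapse`). This is an affine substitution of coordinates x_v, 1 - x_v, 0, 1, and such
substitutions commute with LS₊ (`Literal.subst_mem_lsPlus`).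

Non-isomorphism: i₂ has degree k - i + 2, plus one if i ∈ S, and counting the vertices above a
suitable degree threshold detects an i in S but not in S'. -/

theorem mem_homogenizedCone_iff {y : Option V → ℝ} :
    y ∈ homogenizedCone P ↔ 0 ≤ y none ∧ ∃ x ∈ P, ∀ i, y (some i) = y none * x i := by
  constructor
  · rintro ⟨t, ht, x, hx, rfl, h⟩
    exact ⟨ht, x, hx, h⟩
  · rintro ⟨ht, x, hx, h⟩
    exact ⟨_, ht, x, hx, rfl, h⟩

theorem homogenizedCone_mono (h : P ⊆ Q) : homogenizedCone P ⊆ homogenizedCone Q := by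
  rintro y ⟨t, ht, x, hx, h1⟩
  exact ⟨t, ht, x, h hx, h1⟩

theorem smul_mem_homogenizedCone {y : Option V → ℝ} (hy : y ∈ homogenizedCone P) {a : ℝ}
    (ha : 0 ≤ a) : a • y ∈ homogenizedCone P := by
  obtain ⟨t, ht, x, hx, h0, h1⟩ := hy
  refine ⟨a * t, mul_nonneg ha ht, x, hx, by simp [h0], fun i => ?_⟩
  simp [h1, mul_assoc]

theorem add_mem_homogenizedCone (hP : Convex ℝ P) {y z : Option V → ℝ}
    (hy : y ∈ homogenizedCone P) (hz : z ∈ homogenizedCone P) :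
    y + z ∈ homogenizedCone P := by
  obtain ⟨s, hs, x, hx, h0, h1⟩ := hy
  obtain ⟨t, ht, x', hx', h0', h1'⟩ := hz
  rcases (add_nonneg hs ht).eq_or_lt with h | h
  · have hs0 : s = 0 := by linarith
    have ht0 : t = 0 := by linarith
    exact ⟨0, le_rfl, x, hx, by simp [h0, h0', hs0, ht0], fun i => by simp [h1, h1', hs0, ht0]⟩
  · refine ⟨s + t, h.le, (s / (s + t)) • x + (t / (s + t)) • x',
      hP hx hx' (by positivity) (by positivity) (by field_simp), by simp [h0, h0'], fun i => ?_⟩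
    simp only [Pi.add_apply, Pi.smul_apply, smul_eq_mul, h1, h1']
    field_simp

theorem zero_mem_homogenizedCone (hP : P.Nonempty) : (0 : Option V → ℝ) ∈ homogenizedCone P := by
  obtain ⟨x, hx⟩ := hP
  exact ⟨0, le_rfl, x, hx, rfl, fun i => by simp⟩

theorem sum_mem_homogenizedCone (hP : Convex ℝ P) (hne : P.Nonempty) {ι : Type*} (s : Finset ι)
    (f : ι → Option V → ℝ) (h : ∀ i ∈ s, f i ∈ homogenizedCone P) :
    ∑ i ∈ s, f i ∈ homogenizedCone P :=
  Finset.sum_induction f (· ∈ homogenizedCone P) (fun _ _ => add_mem_homogenizedCone hP)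
    (zero_mem_homogenizedCone hne) h

theorem mem_of_mem_homogenizedCone {x : V → ℝ} {y : Option V → ℝ} (hy : y ∈ homogenizedCone P)
    (h0 : y none = 1) (h1 : ∀ i, y (some i) = x i) : x ∈ P := by
  obtain ⟨t, ht, x', hx', h0', h1'⟩ := hy
  have : x = x' := by
    funext i
    rw [← h1, h1', ← h0', h0, one_mul]
  rwa [this]

theorem lsPlus_mono (h : P ⊆ Q) : lsPlus P ⊆ lsPlus Q := by
  rintro x ⟨Y, ⟨h1, h2, h3⟩, h4⟩
  exact ⟨Y, ⟨h1, h2, fun i => ⟨homogenizedCone_mono h (h3 i).1, homogenizedCone_mono h (h3 i).2⟩⟩,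
    h4⟩

theorem lsPlus_iterate_mono (h : P ⊆ Q) (n : ℕ) : lsPlus^[n] P ⊆ lsPlus^[n] Q := by
  induction n with
  | zero => exact h
  | succ n ih =>
    rw [Function.iterate_succ_apply', Function.iterate_succ_apply']
    exact lsPlus_mono ih

theorem convex_lsPlus (hP : Convex ℝ P) : Convex ℝ (lsPlus P) := by
  rintro x ⟨Y, ⟨h1, h2, h3⟩, h4, h5⟩ x' ⟨Y', ⟨h1', h2', h3'⟩, h4', h5'⟩ a b ha hb hab
  refine ⟨a • Y + b • Y', ⟨(h1.smul ha).add (h1'.smul hb), ?_, fun i => ⟨?_, ?_⟩⟩, ?_, ?_⟩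
  · funext j
    have e := congrFun h2 j
    have e' := congrFun h2' j
    simp only [Matrix.col_apply, Matrix.diag_apply] at e e'
    simp [e, e']
  · have := add_mem_homogenizedCone hP (smul_mem_homogenizedCone (h3 i).1 ha)
      (smul_mem_homogenizedCone (h3' i).1 hb)
    convert this using 1
    rfl
  · have := add_mem_homogenizedCone hP (smul_mem_homogenizedCone (h3 i).2 ha)
      (smul_mem_homogenizedCone (h3' i).2 hb)
    convert this using 1
    funext j
    simp [Matrix.col_apply]
    ring
  · simp only [Matrix.col_apply] at h4 h4' ⊢
    simp [h4, h4', hab]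
  · intro i
    simp only [Matrix.col_apply] at h5 h5' ⊢
    simp [h5, h5']

theorem convex_lsPlus_iterate (hP : Convex ℝ P) (n : ℕ) : Convex ℝ (lsPlus^[n] P) := by
  induction n with
  | zero => exact hP
  | succ n ih =>
    rw [Function.iterate_succ_apply']
    exact convex_lsPlus ih

theorem col_none_mem_homogenizedCone (hP : Convex ℝ P) [Nonempty V]
    {Y : Matrix (Option V) (Option V) ℝ} (hY : Y ∈ lsPlusLift P) :
    Y.col none ∈ homogenizedCone P := by
  obtain ⟨v⟩ := ‹Nonempty V›
  simpa using add_mem_homogenizedCone hP (hY.2.2 v).1 (hY.2.2 v).2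

theorem lsPlus_subset (hP : Convex ℝ P) (hne : P.Nonempty) : lsPlus P ⊆ P := by
  rintro x ⟨Y, hY, h0, h1⟩
  -- Without vertices the cone conditions on `Y` are void, and only nonemptiness of `P` helps.
  rcases isEmpty_or_nonempty V with hV | hV
  · obtain ⟨z, hz⟩ := hne
    rwa [Subsingleton.elim x z]
  · exact mem_of_mem_homogenizedCone (col_none_mem_homogenizedCone hP hY) h0 h1

/-- The rank-one matrix u uᵀ with u = (1, x) is a lift: all its columns are 0 or u. -/
theorem mem_lsPlus_of_zero_one [Finite V] {x : V → ℝ} (hx : x ∈ P)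
    (h01 : ∀ i, x i = 0 ∨ x i = 1) : x ∈ lsPlus P := by
  have := Fintype.ofFinite V
  let u : Option V → ℝ := fun a => a.elim 1 x
  have hu : u ∈ homogenizedCone P := ⟨1, zero_le_one, x, hx, rfl, fun i => by simp [u]⟩
  have h2 : ∀ a, u a = u a * u a := by
    rintro (_ | i)
    · simp [u]
    · rcases h01 i with h | h <;> simp [u, h]
  refine ⟨Matrix.vecMulVec u u, ⟨Matrix.posSemidef_vecMulVec_self_star u, ?_, fun i => ⟨?_, ?_⟩⟩,
    ?_, ?_⟩
  · funext j
    simpa [Matrix.vecMulVec, u] using h2 j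
  · convert smul_mem_homogenizedCone hu (a := x i) (by rcases h01 i with h | h <;> simp [h]) using 1
    funext j
    simp [Matrix.vecMulVec, u, mul_comm]
  · convert smul_mem_homogenizedCone hu (a := 1 - x i)
      (by rcases h01 i with h | h <;> simp [h]) using 1
    funext j
    simp [Matrix.vecMulVec, u]
    ring
  · simp [Matrix.vecMulVec, u]
  · simp [Matrix.vecMulVec, u]

theorem mem_lsPlus_iterate_of_zero_one [Finite V] {x : V → ℝ} (hx : x ∈ P)
    (h01 : ∀ i, x i = 0 ∨ x i = 1) (n : ℕ) : x ∈ lsPlus^[n] P := by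
  induction n with
  | zero => exact hx
  | succ n ih =>
    rw [Function.iterate_succ_apply']
    exact mem_lsPlus_of_zero_one ih h01

theorem integerHull_subset_lsPlus_iterate [Finite V] (hP : Convex ℝ P) (n : ℕ) :
    integerHull P ⊆ lsPlus^[n] P :=
  convexHull_min (fun _ hx => mem_lsPlus_iterate_of_zero_one hx.1 hx.2 n)
    (convex_lsPlus_iterate hP n)

theorem lsPlus_iterate_antitone [Finite V] (hP : Convex ℝ P) (h0 : 0 ∈ P) :
    Antitone fun n => lsPlus^[n] P := by
  refine antitone_nat_of_succ_le fun n => ?_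
  rw [Function.iterate_succ_apply']
  exact lsPlus_subset (convex_lsPlus_iterate hP n)
    ⟨0, mem_lsPlus_iterate_of_zero_one h0 (by simp) n⟩

end Cone

/-! ### Literal substitutions -/

/-- A literal over `V`: a constant `0` or `1`, a variable, or the complement of a variable. -/
inductive Literal (V : Type*)
  | zero
  | one
  | pos (v : V)
  | neg (v : V)

namespace Literal

variable {V W : Type*}

/-- The value of a literal. -/
def eval (x : V → ℝ) : Literal V → ℝ
  | zero => 0
  | one => 1
  | pos v => x v
  | neg v => 1 - x v

/-- The homogenized value of a literal. -/
def homEval (y : Option V → ℝ) : Literal V → ℝ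
  | zero => 0
  | one => y none
  | pos v => y (some v)
  | neg v => y none - y (some v)

/-- The point obtained by substituting literals. -/
def subst (f : W → Literal V) (x : V → ℝ) : W → ℝ := fun w => (f w).eval x

/-- The homogenization of `Literal.subst`. -/
def homSubst (f : W → Literal V) : (Option V → ℝ) →ₗ[ℝ] (Option W → ℝ) where
  toFun y a := a.elim (y none) fun w => (f w).homEval y
  map_add' y z := by
    funext a
    rcases a with _ | w
    · simp
    · cases h : f w <;> simp [h, homEval]
      ring
  map_smul' c y := by
    funext a
    rcases a with _ | w
    · simp
    · cases h : f w <;> simp [h, homEval]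
      ring

@[simp] theorem homSubst_none (f : W → Literal V) (y : Option V → ℝ) :
    homSubst f y none = y none := rfl

@[simp] theorem homSubst_some (f : W → Literal V) (y : Option V → ℝ) (w : W) :
    homSubst f y (some w) = (f w).homEval y := rfl

theorem homSubst_mem_homogenizedCone {f : W → Literal V} {P : Set (V → ℝ)} {Q : Set (W → ℝ)}
    (h : ∀ x ∈ P, subst f x ∈ Q) {y : Option V → ℝ} (hy : y ∈ homogenizedCone P) :
    homSubst f y ∈ homogenizedCone Q := by
  obtain ⟨t, ht, x, hx, h0, h1⟩ := hy
  refine ⟨t, ht, subst f x, h x hx, h0, fun w => ?_⟩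
  cases h : f w <;> simp [h, homEval, subst, eval, h0, h1]
  ring

theorem subst_combo (f : W → Literal V) (x y : V → ℝ) {a b : ℝ} (hab : a + b = 1) :
    subst f (a • x + b • y) = a • subst f x + b • subst f y := by
  obtain rfl : b = 1 - a := by linarith
  funext w
  cases h : f w <;> simp [subst, h, eval]
  ring

theorem subst_mem_integerHull {f : W → Literal V} {P : Set (V → ℝ)} {Q : Set (W → ℝ)}
    (h : ∀ x ∈ P, subst f x ∈ Q) {x : V → ℝ} (hx : x ∈ integerHull P) :
    subst f x ∈ integerHull Q := by
  have hc : Convex ℝ {x | subst f x ∈ integerHull Q} := by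
    intro x hx y hy a b ha hb hab
    rw [Set.mem_ofPred_eq, subst_combo f x y hab]
    exact convex_convexHull ℝ _ hx hy ha hb hab
  refine convexHull_min (fun z hz => ?_) hc hx
  refine subset_convexHull ℝ _ ⟨h z hz.1, fun w => ?_⟩
  cases hf : f w with
  | zero => simp [subst, hf, eval]
  | one => simp [subst, hf, eval]
  | pos v => simpa [subst, hf, eval] using hz.2 v
  | neg v => rcases hz.2 v with h | h <;> simp [subst, hf, eval, h]

/-- The coefficients of the homogenized value of a literal. -/
def row [DecidableEq V] : Literal V → Option V → ℝ
  | zero => 0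
  | one => Pi.single none 1
  | pos v => Pi.single (some v) 1
  | neg v => Pi.single none 1 - Pi.single (some v) 1

/-- The matrix of `Literal.homSubst`. -/
def toMatrix [DecidableEq V] (f : W → Literal V) : Matrix (Option W) (Option V) ℝ :=
  Matrix.of fun a => a.elim (Pi.single none 1) fun w => (f w).row

theorem toMatrix_none [DecidableEq V] (f : W → Literal V) :
    toMatrix f none = Pi.single none 1 := rfl

theorem toMatrix_some [DecidableEq V] (f : W → Literal V) (w : W) :
    toMatrix f (some w) = (f w).row := rfl

theorem toMatrix_mulVec [Fintype V] [DecidableEq V] (f : W → Literal V) (y : Option V → ℝ) :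
    Matrix.mulVec (toMatrix f) y = homSubst f y := by
  funext a
  rcases a with _ | w
  · simp [Matrix.mulVec, toMatrix_none]
  · change (f w).row ⬝ᵥ y = (f w).homEval y
    cases f w <;> simp [row, homEval, sub_dotProduct]

/-- With M the matrix of the homogenized substitution, M Y Mᵀ lifts the image point. Its columns are
the images under M of 0, Y e₀, Y e_v or Y(e₀ - e_v), and complementing a literal merely exchanges
the last two, so the cone conditions carry over. -/
theorem subst_mem_lsPlus [Finite V] [Finite W] {f : W → Literal V} {P : Set (V → ℝ)}
    {Q : Set (W → ℝ)} (hP : Convex ℝ P) (hP0 : 0 ∈ P) (h : ∀ x ∈ P, subst f x ∈ Q) {x : V → ℝ}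
    (hx : x ∈ lsPlus P) : subst f x ∈ lsPlus Q := by
  classical
  have := Fintype.ofFinite V
  have := Fintype.ofFinite W
  have hxP : x ∈ P := lsPlus_subset hP ⟨0, hP0⟩ hx
  obtain ⟨Y, ⟨hpsd, hdiag, hcol⟩, h0, h1⟩ := hx
  have hne : Y.col none ∈ homogenizedCone P :=
    ⟨1, zero_le_one, x, hxP, h0, fun i => by rw [h1, one_mul]⟩
  have hz : (0 : Option V → ℝ) ∈ homogenizedCone P := zero_mem_homogenizedCone ⟨0, hP0⟩
  have hd : ∀ a, Y a none = Y a a := fun a => congrFun hdiag a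
  have hs : ∀ a b, Y a b = Y b a := fun a b => by simpa using (hpsd.1.apply a b).symm
  set Z := toMatrix f * Y * (toMatrix f).conjTranspose with hZ
  have hZcol : ∀ b, Z.col b = homSubst f (Matrix.mulVec Y (toMatrix f b)) := by
    intro b
    rw [← toMatrix_mulVec, Matrix.mulVec_mulVec]
    funext a
    simp [hZ, Matrix.col_apply, Matrix.mul_apply (M := toMatrix f * Y), Matrix.mulVec, dotProduct]
  have hZnone : Z.col none = homSubst f (Y.col none) := by
    rw [hZcol]
    simp [toMatrix_none]
  have hZzero : ∀ w, f w = zero → Z.col (some w) = homSubst f 0 := by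
    intro w hw
    rw [hZcol]
    simp [toMatrix_some, hw, row]
  have hZone : ∀ w, f w = one → Z.col (some w) = homSubst f (Y.col none) := by
    intro w hw
    rw [hZcol]
    simp [toMatrix_some, hw, row]
  have hZpos : ∀ w v, f w = pos v → Z.col (some w) = homSubst f (Y.col (some v)) := by
    intro w v hw
    rw [hZcol]
    simp [toMatrix_some, hw, row]
  have hZneg : ∀ w v, f w = neg v →
      Z.col (some w) = homSubst f (Y.col none - Y.col (some v)) := by
    intro w v hw
    rw [hZcol]
    simp [toMatrix_some, hw, row, Matrix.mulVec_sub]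
  refine ⟨Z, ⟨hpsd.mul_mul_conjTranspose_same _, ?_, fun w => ?_⟩, ?_, fun w => ?_⟩
  · funext a
    rw [Matrix.diag_apply, ← Matrix.col_apply Z a a]
    rcases a with _ | w
    · rfl
    · cases hw : f w with
      | zero => rw [hZzero w hw, hZnone]; simp [hw, homEval]
      | one => rw [hZone w hw, hZnone]
      | pos v => rw [hZpos w v hw, hZnone]; simp [hw, homEval, hd]
      | neg v =>
        rw [hZneg w v hw, hZnone]
        simp [hw, homEval, hs none (some v), hd (some v)]
  · rw [hZnone]
    cases hw : f w with
    | zero =>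
      rw [hZzero w hw, ← map_sub]
      exact ⟨homSubst_mem_homogenizedCone h hz, homSubst_mem_homogenizedCone h (by simpa using hne)⟩
    | one =>
      rw [hZone w hw, ← map_sub]
      exact ⟨homSubst_mem_homogenizedCone h hne, homSubst_mem_homogenizedCone h (by simpa using hz)⟩
    | pos v =>
      rw [hZpos w v hw, ← map_sub]
      exact ⟨homSubst_mem_homogenizedCone h (hcol v).1, homSubst_mem_homogenizedCone h (hcol v).2⟩
    | neg v =>
      rw [hZneg w v hw, ← map_sub]
      exact ⟨homSubst_mem_homogenizedCone h (hcol v).2,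
        homSubst_mem_homogenizedCone h (by simpa using (hcol v).1)⟩
  · rw [hZnone]; exact h0
  · rw [hZnone]
    simp only [Matrix.col_apply] at h0 h1
    cases hw : f w <;> simp [hw, homEval, subst, eval, h0, h1]

theorem subst_mem_lsPlus_iterate [Finite V] [Finite W] {f : W → Literal V} {P : Set (V → ℝ)}
    {Q : Set (W → ℝ)} (hP : Convex ℝ P) (hP0 : 0 ∈ P) (h : ∀ x ∈ P, subst f x ∈ Q) (n : ℕ)
    {x : V → ℝ} (hx : x ∈ lsPlus^[n] P) : subst f x ∈ lsPlus^[n] Q := by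
  induction n generalizing x with
  | zero => exact h x hx
  | succ n ih =>
    rw [Function.iterate_succ_apply'] at hx ⊢
    exact subst_mem_lsPlus (convex_lsPlus_iterate hP n)
      (mem_lsPlus_iterate_of_zero_one hP0 (by simp) n) (fun _ => ih) hx

end Literal

/-! ### The upper bound `r₊(G) ≤ |V| / 3` -/

section FracPolytope

variable {V : Type*}

theorem convex_fracPolytope (G : SimpleGraph V) : Convex ℝ (fracPolytope G) := by
  rintro x ⟨hx, hx'⟩ y ⟨hy, hy'⟩ a b ha hb hab
  obtain rfl : b = 1 - a := by linarith
  refine ⟨fun i => ⟨?_, ?_⟩, fun i j hij => ?_⟩ <;>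
    simp only [Pi.add_apply, Pi.smul_apply, smul_eq_mul]
  · have := mul_nonneg ha (hx i).1
    have := mul_nonneg hb (hy i).1
    linarith
  · have := mul_le_mul_of_nonneg_left (hx i).2 ha
    have := mul_le_mul_of_nonneg_left (hy i).2 hb
    linarith
  · have := mul_le_mul_of_nonneg_left (hx' i j hij) ha
    have := mul_le_mul_of_nonneg_left (hy' i j hij) hb
    linarith

theorem zero_mem_fracPolytope (G : SimpleGraph V) : 0 ∈ fracPolytope G := by
  refine ⟨fun i => by simp, fun i j _ => by simp⟩

theorem fracPolytope_anti {G H : SimpleGraph V} (h : G ≤ H) : fracPolytope H ⊆ fracPolytope G :=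
  fun _ hx => ⟨hx.1, fun i j hij => hx.2 i j (h hij)⟩

theorem lsPlus_iterate_fracPolytope_subset [Finite V] (G : SimpleGraph V) (n : ℕ) :
    lsPlus^[n] (fracPolytope G) ⊆ fracPolytope G :=
  lsPlus_iterate_antitone (convex_fracPolytope G) (zero_mem_fracPolytope G) (Nat.zero_le n)

theorem finite_zero_one [Finite V] : {x : V → ℝ | ∀ i, x i = 0 ∨ x i = 1}.Finite := by
  have : {x : V → ℝ | ∀ i, x i = 0 ∨ x i = 1} = Set.univ.pi fun _ => {0, 1} := by
    ext x
    simp [Set.mem_pi]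
  rw [this]
  exact Set.Finite.pi fun _ => Set.toFinite _

theorem isClosed_integerHull [Finite V] (P : Set (V → ℝ)) : IsClosed (integerHull P) :=
  ((finite_zero_one.subset Set.inter_subset_right).isCompact_convexHull ℝ).isClosed

/-- A point of the fractional stable set polytope satisfying all nonnegative valid inequalities of
the stable set polytope belongs to it. -/
theorem mem_integerHull_of_forall_nonneg [Fintype V] {G : SimpleGraph V} {x : V → ℝ}
    (hx : ∀ i, 0 ≤ x i)
    (h : ∀ (a : V → ℝ) (β : ℝ), (∀ i, 0 ≤ a i) →
      (∀ z ∈ integerHull (fracPolytope G), ∑ i, a i * z i ≤ β) → ∑ i, a i * x i ≤ β) :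
    x ∈ integerHull (fracPolytope G) := by
  classical
  by_contra hxn
  obtain ⟨f, u, hf, hu⟩ := geometric_hahn_banach_closed_point (convex_convexHull ℝ _)
    (isClosed_integerHull (fracPolytope G)) hxn
  set a : V → ℝ := fun i => f (Pi.single i 1) with ha
  have hfa : ∀ z : V → ℝ, f z = ∑ i, a i * z i := by
    intro z
    have := LinearMap.pi_apply_eq_sum_univ f.toLinearMap z
    simp only [smul_eq_mul] at this
    rw [show f z = f.toLinearMap z from rfl, this]
    refine Finset.sum_congr rfl fun i _ => ?_
    rw [mul_comm, ha]
    have : (fun j => if i = j then (1 : ℝ) else 0) = Pi.single i 1 := by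
      funext j
      simp [Pi.single_apply, eq_comm]
    rw [this]
    rfl
  have key := h (fun i => max (a i) 0) u (fun i => le_max_right _ _) ?_
  · have : ∑ i, a i * x i ≤ ∑ i, max (a i) 0 * x i :=
      Finset.sum_le_sum fun i _ => mul_le_mul_of_nonneg_right (le_max_left _ _) (hx i)
    rw [hfa] at hu
    linarith
  · have hc : Convex ℝ {z : V → ℝ | ∑ i, max (a i) 0 * z i ≤ u} := by
      refine convex_halfSpace_le (𝕜 := ℝ) (f := fun z : V → ℝ => ∑ i, max (a i) 0 * z i) ⟨?_, ?_⟩ u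
      · intro z z'
        simp [mul_add, Finset.sum_add_distrib]
      · intro c z
        simp only [Pi.smul_apply, smul_eq_mul, Finset.mul_sum]
        exact Finset.sum_congr rfl fun i _ => by ring
    refine fun z hz => convexHull_min (fun z hz => ?_) hc hz
    obtain ⟨⟨hz1, hz2⟩, hz3⟩ := hz
    -- Stable sets are closed under taking subsets, so negative coefficients may be raised to 0
    -- without losing validity.
    set z' : V → ℝ := fun i => if 0 ≤ a i then z i else 0 with hz'
    have hle : ∀ i, 0 ≤ z' i ∧ z' i ≤ z i := by
      intro i
      simp only [hz']
      split_ifs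
      · exact ⟨(hz1 i).1, le_rfl⟩
      · exact ⟨le_rfl, (hz1 i).1⟩
    have hmem : z' ∈ integerHull (fracPolytope G) := by
      refine subset_convexHull ℝ _ ⟨⟨fun i => ⟨(hle i).1, (hle i).2.trans (hz1 i).2⟩,
        fun i j hij => (add_le_add (hle i).2 (hle j).2).trans (hz2 i j hij)⟩, fun i => ?_⟩
      simp only [hz']
      split_ifs
      · exact hz3 i
      · exact Or.inl rfl
    have h1 := (hf z' hmem).le
    rw [hfa] at h1
    refine le_trans (Finset.sum_le_sum fun i _ => ?_) h1
    simp only [hz']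
    split_ifs with hi
    · simp [max_eq_left hi]
    · simp [max_eq_right (not_le.1 hi).le]

/-- If all columns of all lifted matrices lie in the cone of the stable set polytope, then one
application of `LS₊` suffices. -/
theorem lsPlus_subset_integerHull [Finite V] {G : SimpleGraph V} {P : Set (V → ℝ)}
    (hP : P ⊆ fracPolytope G) (hconv : Convex ℝ P) (hP0 : 0 ∈ P)
    (h : ∀ i, ∀ y ∈ P, y i = 1 → y ∈ integerHull (fracPolytope G)) :
    lsPlus P ⊆ integerHull (fracPolytope G) := by
  classical
  have := Fintype.ofFinite V
  intro x hx
  have hxP := hP (lsPlus_subset hconv ⟨0, hP0⟩ hx)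
  obtain ⟨Y, ⟨hpsd, hdiag, hcol⟩, h0, h1⟩ := hx
  refine mem_integerHull_of_forall_nonneg (fun i => (hxP.1 i).1) fun a β ha hβ => ?_
  have hd : ∀ a, Y a none = Y a a := fun a => congrFun hdiag a
  have hs : ∀ a b, Y a b = Y b a := fun a b => by simpa using (hpsd.1.apply a b).symm
  have h00 : Y none none = 1 := h0
  have hx1 : ∀ i, Y (some i) none = x i := h1
  have hβ0 : 0 ≤ β := by
    have := hβ 0 (subset_convexHull ℝ _ ⟨zero_mem_fracPolytope G, by simp⟩)
    simpa using this
  have hcolle : ∀ i, ∑ j, a j * Y (some j) (some i) ≤ β * x i := by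
    intro i
    obtain ⟨ht, y, hy, hyi⟩ := mem_homogenizedCone_iff.1 (hcol i).1
    simp only [Matrix.col_apply] at ht hyi
    rw [hs, hx1] at ht
    simp only [hs none, hx1] at hyi
    simp only [hyi]
    rcases ht.eq_or_lt with h | hpos
    · simp [← h]
    · have hy1 : y i = 1 := by
        have := hyi i
        rw [← hd, hx1] at this
        nlinarith
      have := hβ y (h i y hy hy1)
      calc ∑ j, a j * (x i * y j) = (∑ j, a j * y j) * x i := by
            rw [Finset.sum_mul]
            exact Finset.sum_congr rfl fun j _ => by ring
        _ ≤ β * x i := mul_le_mul_of_nonneg_right this ht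
  set s := ∑ i, a i * x i with hsdef
  have hquad : ∑ i, a i * ∑ j, a j * Y (some j) (some i) ≤ β * s := by
    rw [hsdef, Finset.mul_sum]
    refine Finset.sum_le_sum fun i _ => ?_
    have := mul_le_mul_of_nonneg_left (hcolle i) (ha i)
    linarith
  -- Testing `Y` on (-s, a) gives s² ≤ aᵀXa for the block X of `Y` indexed by vertices, while the
  -- column inequalities give aᵀXa ≤ β s. Hence s ≤ β.
  have hpos := hpsd.dotProduct_mulVec_nonneg (fun b => b.elim (-s) a)
  simp only [dotProduct, Matrix.mulVec, Fintype.sum_option, star_trivial, Option.elim_none,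
    Option.elim_some, h00, hs none, hx1] at hpos
  have e1 : ∑ j, x j * a j = s := by
    rw [hsdef]
    exact Finset.sum_congr rfl fun j _ => mul_comm _ _
  have e2 : ∑ i, a i * (x i * -s + ∑ j, Y (some i) (some j) * a j) =
      -s * s + ∑ i, a i * ∑ j, a j * Y (some j) (some i) := by
    conv_rhs => rw [hsdef, Finset.mul_sum, ← Finset.sum_add_distrib]
    refine Finset.sum_congr rfl fun i _ => ?_
    have : ∑ j, Y (some i) (some j) * a j = ∑ j, a j * Y (some j) (some i) :=
      Finset.sum_congr rfl fun j _ => by rw [hs, mul_comm]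
    rw [this, ← hsdef]
    ring
  rw [e1, e2] at hpos
  by_contra! hlt
  nlinarith

open Literal in
/-- The `LS₊`-rank of a graph on `n` vertices is at most `n / 3` (Lipták–Tunçel). -/
theorem lsPlus_iterate_subset_integerHull (n : ℕ) : ∀ {V : Type*} [Fintype V]
    (G : SimpleGraph V), Fintype.card V = n →
    lsPlus^[n / 3] (fracPolytope G) ⊆ integerHull (fracPolytope G) := by
  classical
  induction n using Nat.strong_induction_on with
  | _ n ih =>
  intro V _ G hn
  have hrestrict : ∀ (p : V → Prop) [Fintype {v // p v}] (r : ℕ) (x : V → ℝ), x ∈ lsPlus^[r] (fracPolytope G) →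
      Fintype.card {v // p v} < n → Fintype.card {v // p v} / 3 ≤ r →
      (fun v : {v // p v} => x v) ∈ integerHull (fracPolytope (G.induce {v | p v})) := by
    intro p _ r x hx hlt hle
    refine ih _ hlt (V := {v // p v}) (G.induce {v | p v}) rfl ?_
    refine lsPlus_iterate_antitone (convex_fracPolytope _) (zero_mem_fracPolytope _) hle ?_
    exact subst_mem_lsPlus_iterate (f := fun v : {v // p v} => pos (v : V))
      (Q := fracPolytope (V := {v // p v}) (G.induce {v | p v})) (convex_fracPolytope G) (zero_mem_fracPolytope G)
      (fun z (hz : z ∈ fracPolytope G) => ⟨fun i => hz.1 i, fun i j hij => hz.2 i j hij⟩) r hx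
  by_cases hdeg : ∃ v, G.degree v ≤ 1
  · obtain ⟨v, hv⟩ := hdeg
    intro x hx
    have hxF := lsPlus_iterate_fracPolytope_subset G _ hx
    have hcard : Fintype.card {w // w ≠ v} = n - 1 := by
      rw [Fintype.card_subtype_compl, Fintype.card_subtype_eq, hn]
    have hn1 : 1 ≤ n := by
      rw [← hn]
      exact Fintype.card_pos_iff.2 ⟨v⟩
    have hW := hrestrict (· ≠ v) _ x hx (by rw [hcard]; omega)
      (by rw [hcard]; exact Nat.div_le_div_right (Nat.sub_le _ _))
    -- `ℓ` is the largest value the edges allow at `v`: 1 - x_u for the only neighbour u, or 1 if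
    -- `v` is isolated.
    obtain ⟨ℓ, hℓ⟩ : ∃ ℓ : Literal {w // w ≠ v}, (∀ z : {w // w ≠ v} → ℝ,
        (∀ w, 0 ≤ z w ∧ z w ≤ 1) → 0 ≤ ℓ.eval z ∧ ℓ.eval z ≤ 1 ∧
          ∀ w : {w // w ≠ v}, G.Adj v w → ℓ.eval z + z w ≤ 1) ∧
        x v ≤ ℓ.eval (fun w : {w // w ≠ v} => x w) := by
      by_cases hu : ∃ u, G.Adj v u
      · obtain ⟨u, hu⟩ := hu
        have huniq : ∀ w, G.Adj v w → w = u := by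
          intro w hw
          by_contra hne
          have : ({w, u} : Finset V) ⊆ G.neighborFinset v := by
            intro t ht
            simp only [Finset.mem_insert, Finset.mem_singleton] at ht
            rcases ht with rfl | rfl <;> simpa
          have := Finset.card_le_card this
          rw [Finset.card_pair hne, G.card_neighborFinset_eq_degree] at this
          omega
        refine ⟨neg ⟨u, hu.ne'⟩, fun z hz => ⟨?_, ?_, fun w hw => ?_⟩, ?_⟩
        · simpa [eval] using (hz _).2
        · simpa [eval] using (hz _).1
        · obtain rfl : w = ⟨u, hu.ne'⟩ := Subtype.ext (huniq w hw)
          simp [eval]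
        · have := hxF.2 v u hu
          simp only [eval]
          linarith
      · refine ⟨one, fun z hz => ⟨by simp [eval], by simp [eval], fun w hw => ?_⟩, ?_⟩
        · exact absurd ⟨_, hw⟩ hu
        · simpa [eval] using (hxF.1 v).2
    have hext : ∀ l : Literal {w // w ≠ v}, (∀ z : {w // w ≠ v} → ℝ,
        (∀ w, 0 ≤ z w ∧ z w ≤ 1) → 0 ≤ l.eval z ∧ l.eval z ≤ 1 ∧
          ∀ w : {w // w ≠ v}, G.Adj v w → l.eval z + z w ≤ 1) →
        subst (fun w => if h : w = v then l else pos ⟨w, h⟩) (fun w : {w // w ≠ v} => x w) ∈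
          integerHull (fracPolytope G) := by
      intro l hl
      refine subst_mem_integerHull (fun z hz => ?_) hW
      obtain ⟨h0, h1, h2⟩ := hl z hz.1
      refine ⟨fun i => ?_, fun i j hij => ?_⟩
      · by_cases hi : i = v
        · simp [subst, hi, h0, h1]
        · simpa [subst, hi, eval] using hz.1 ⟨i, hi⟩
      · by_cases hi : i = v
        · subst hi
          have hj : j ≠ i := hij.ne'
          simpa [Literal.subst, hj, eval] using h2 ⟨j, hj⟩ hij
        · by_cases hj : j = v
          · subst hj
            have := h2 ⟨i, hi⟩ hij.symm
            simp only [Literal.subst, hi, dite_true, dite_false]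
            change z ⟨i, hi⟩ + eval z l ≤ 1
            linarith
          · simpa [Literal.subst, hi, hj, eval] using hz.2 ⟨i, hi⟩ ⟨j, hj⟩ hij
    have hA := hext ℓ hℓ.1
    have hB := hext zero fun z hz => by simpa [eval] using fun w hw _ => (hz ⟨w, hw⟩).2
    have hxv := hxF.1 v
    set L := ℓ.eval (fun w : {w // w ≠ v} => x w) with hL
    rcases hxv.1.eq_or_lt with hx0 | hxpos
    · convert hB using 1
      funext w
      by_cases hw : w = v
      · simp [subst, hw, eval, ← hx0]
      · simp [subst, hw, eval]
    · have hLpos : 0 < L := hxpos.trans_le hℓ.2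
      -- The point `x` lies on the segment between its modifications with value `L` and with value 0
      -- at `v`, both in the integer hull.
      have := convex_convexHull ℝ _ hA hB (a := x v / L) (b := 1 - x v / L) (by positivity)
        (by rw [sub_nonneg, div_le_one hLpos]; exact hℓ.2) (by ring)
      refine Set.mem_of_eq_of_mem ?_ this
      funext w
      by_cases hw : w = v
      · simp only [Pi.add_apply, Pi.smul_apply, smul_eq_mul, subst, hw, dite_true, ← hL]
        simp [eval, hLpos.ne']
      · simp only [Pi.add_apply, Pi.smul_apply, smul_eq_mul, subst, hw, dite_false, eval]
        ring
  · push Not at hdeg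
    rcases isEmpty_or_nonempty V with hV | ⟨⟨v₀⟩⟩
    · intro x _
      refine subset_convexHull ℝ _ ⟨?_, fun i => hV.elim i⟩
      exact ⟨fun i => hV.elim i, fun i => hV.elim i⟩
    have hcardW : ∀ v, Fintype.card {w // ¬ (w = v ∨ G.Adj v w)} + 3 ≤ n := by
      intro v
      have h1 : Fintype.card {w // w = v ∨ G.Adj v w} = G.degree v + 1 := by
        rw [Fintype.card_subtype, ← G.card_neighborFinset_eq_degree,
          ← Finset.card_insert_of_notMem (G.notMem_neighborFinset_self v)]
        congr 1
        ext w
        simp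
      have h2 := Fintype.card_subtype_compl fun w => w = v ∨ G.Adj v w
      have h3 := Fintype.card_subtype_le fun w => w = v ∨ G.Adj v w
      have := hdeg v
      omega
    -- Closed neighbourhoods have at least three vertices. The first (n - 3)/3 applications make the
    -- faces y_v = 1 integral; the last one is for `lsPlus_subset_integerHull`.
    have hn3 : n / 3 = (n - 3) / 3 + 1 := by
      have := hcardW v₀
      omega
    rw [hn3, Function.iterate_succ_apply']
    refine lsPlus_subset_integerHull (lsPlus_iterate_fracPolytope_subset G _)
      (convex_lsPlus_iterate (convex_fracPolytope G) _)
      (mem_lsPlus_iterate_of_zero_one (zero_mem_fracPolytope G) (by simp) _) fun v y hy hyv => ?_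
    have hcW := hcardW v
    have hW := hrestrict (fun w => ¬ (w = v ∨ G.Adj v w)) _ y hy (by omega)
      (Nat.div_le_div_right (by omega))
    have hyF := lsPlus_iterate_fracPolytope_subset G _ hy
    have := subst_mem_integerHull (Q := fracPolytope G)
      (f := fun w => if h : w = v ∨ G.Adj v w then (if w = v then one else zero) else pos ⟨w, h⟩)
      (fun z hz => ⟨fun i => ?_, fun i j hij => ?_⟩) hW
    · convert this using 1
      funext w
      by_cases h1 : w = v
      · simp [subst, h1, eval, hyv]
      · by_cases h2 : G.Adj v w
        · have h3 := hyF.2 v w h2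
          have h4 := (hyF.1 w).1
          simp only [subst, h1, h2, eval, or_true, dite_true, if_false]
          linarith
        · simp [subst, h1, h2, eval]
    · by_cases h1 : i = v
      · simp [subst, h1, eval]
      · by_cases h2 : G.Adj v i
        · simp [subst, h1, h2, eval]
        · simpa [subst, h1, h2, eval] using hz.1 ⟨i, by simp [h1, h2]⟩
    · have hb : ∀ w, ∀ l : ℝ, l = (if h : w = v ∨ G.Adj v w then (if w = v then one else zero)
          else pos (⟨w, h⟩ : {w // ¬ (w = v ∨ G.Adj v w)})).eval z → l ≤ 1 := by
        rintro w l rfl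
        split_ifs
        · simp [eval]
        · simp [eval]
        · exact (hz.1 _).2
      have hi := hb i _ rfl
      have hj := hb j _ rfl
      simp only [Literal.subst]
      by_cases h1 : i = v ∨ G.Adj v i
      · by_cases h1' : i = v
        · have : G.Adj v j := h1' ▸ hij
          have hjv : j ≠ v := this.ne'
          simp [h1', this, hjv, eval]
        · simp only [dif_pos h1, if_neg h1'] at hi ⊢
          simpa [eval] using hj
      · by_cases h2 : j = v ∨ G.Adj v j
        · by_cases h2' : j = v
          · exact absurd (Or.inr (h2' ▸ hij.symm)) h1
          · simp only [dif_pos h2, if_neg h2'] at hj ⊢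
            simpa [eval] using hi
        · simpa only [dif_neg h1, dif_neg h2, eval] using hz.2 ⟨i, h1⟩ ⟨j, h2⟩ hij

end FracPolytope

/-! ### Perturbing a sum of rank-one lifted matrices -/

section Perturbation

open Filter Topology

variable {V : Type*} {P : Set (V → ℝ)}

theorem eventually_mul_le_one (a : ℝ) : ∀ᶠ ε in 𝓝[>] (0 : ℝ), ε * a ≤ 1 := by
  have : Tendsto (fun ε : ℝ => ε * a) (𝓝[>] 0) (𝓝 (0 * a)) :=
    (tendsto_nhdsWithin_of_tendsto_nhds tendsto_id).mul_const a
  rw [zero_mul] at this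
  exact this.eventually_le_const one_pos

/-- The sum of all generators is in the relative interior of the cone they generate, so a small
multiple of any vector in their span can be subtracted: the coefficients 1 - ε a_u stay nonnegative.
-/
theorem eventually_sum_add_smul_mem_homogenizedCone (hP : Convex ℝ P) (hne : P.Nonempty)
    {F : Finset (Option V → ℝ)} (hF : ∀ u ∈ F, u ∈ homogenizedCone P) {c l : Option V → ℝ}
    (hc : c ∈ homogenizedCone P) (hl : l ∈ Submodule.span ℝ (F : Set (Option V → ℝ))) :
    ∀ᶠ ε in 𝓝[>] (0 : ℝ), ∑ u ∈ F, u + ε • (c - l) ∈ homogenizedCone P := by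
  obtain ⟨a, -, ha⟩ := Submodule.mem_span_finset.1 hl
  have h1 : ∀ᶠ ε in 𝓝[>] (0 : ℝ), ∀ u ∈ F, ε * a u ≤ 1 :=
    (F.eventually_all).2 fun u _ => eventually_mul_le_one _
  filter_upwards [h1, self_mem_nhdsWithin] with ε hε hpos
  have : ∑ u ∈ F, u + ε • (c - l) = ∑ u ∈ F, (1 - ε * a u) • u + ε • c := by
    rw [← ha, smul_sub, Finset.smul_sum]
    simp only [sub_smul, one_smul, mul_smul, Finset.sum_sub_distrib]
    abel
  rw [this]
  refine add_mem_homogenizedCone hP (sum_mem_homogenizedCone hP hne _ _ fun u hu => ?_)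
    (smul_mem_homogenizedCone hc (le_of_lt hpos))
  exact smul_mem_homogenizedCone (hF u hu) (sub_nonneg.2 (hε u hu))

/-- Write x = β y + ∑ a_u u. For a test vector z, with q = z·y and l = ∑ a_u (z·u), the perturbation
is (βq + l)² - g q² ≥ (q + βl)² - β² l² ≥ -β² l². By Cauchy–Schwarz, l² is dominated by ∑ (z·u)²,
which absorbs this loss for small ε. -/
theorem eventually_posSemidef {ι : Type*} [Fintype ι] {F : Finset (ι → ℝ)} {x y : ι → ℝ}
    {β g : ℝ} (hg : g + 1 ≤ β ^ 2) (h : x - β • y ∈ Submodule.span ℝ (F : Set (ι → ℝ))) :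
    ∀ᶠ ε in 𝓝[>] (0 : ℝ), (∑ u ∈ F, Matrix.vecMulVec u u +
      ε • (Matrix.vecMulVec x x - g • Matrix.vecMulVec y y)).PosSemidef := by
  obtain ⟨a, -, ha⟩ := Submodule.mem_span_finset.1 h
  filter_upwards [eventually_mul_le_one (β ^ 2 * ∑ u ∈ F, a u ^ 2), self_mem_nhdsWithin]
    with ε hε hpos
  have hpos' : 0 < ε := hpos
  refine Matrix.PosSemidef.of_dotProduct_mulVec_nonneg ?_ fun z => ?_
  · ext i j
    simp [Matrix.vecMulVec, Matrix.sum_apply, mul_comm]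
  have hquad : ∀ u : ι → ℝ, z ⬝ᵥ (Matrix.vecMulVec u u).mulVec z = (z ⬝ᵥ u) ^ 2 := by
    intro u
    rw [Matrix.vecMulVec_mulVec, dotProduct_comm u z]
    simp [dotProduct_smul, sq]
  set q := z ⬝ᵥ y
  set l := ∑ u ∈ F, a u * (z ⬝ᵥ u)
  set Q := ∑ u ∈ F, (z ⬝ᵥ u) ^ 2
  have hx : z ⬝ᵥ x = β * q + l := by
    have : x = β • y + ∑ u ∈ F, a u • u := by rw [ha]; abel
    rw [this, dotProduct_add, dotProduct_smul, dotProduct_sum]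
    simp [q, l, dotProduct_smul]
  have hcs : l ^ 2 ≤ (∑ u ∈ F, a u ^ 2) * Q := Finset.sum_mul_sq_le_sq_mul_sq F _ _
  have hQ : 0 ≤ Q := Finset.sum_nonneg fun _ _ => sq_nonneg _
  have hval : star z ⬝ᵥ (∑ u ∈ F, Matrix.vecMulVec u u +
      ε • (Matrix.vecMulVec x x - g • Matrix.vecMulVec y y)).mulVec z =
      Q + ε * ((β * q + l) ^ 2 - g * q ^ 2) := by
    rw [star_trivial, Matrix.add_mulVec, Matrix.sum_mulVec, Matrix.smul_mulVec, Matrix.sub_mulVec,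
      Matrix.smul_mulVec, dotProduct_add, dotProduct_sum, dotProduct_smul, dotProduct_sub,
      dotProduct_smul, hquad, hquad, hx]
    simp only [hquad, smul_eq_mul]
    rfl
  rw [hval]
  have h1 : -(β ^ 2 * l ^ 2) ≤ (β * q + l) ^ 2 - g * q ^ 2 := by
    nlinarith [sq_nonneg (q + β * l), sq_nonneg q, sq_nonneg l]
  have h2 : ε * (β ^ 2 * l ^ 2) ≤ Q := by
    calc ε * (β ^ 2 * l ^ 2) ≤ ε * (β ^ 2 * ((∑ u ∈ F, a u ^ 2) * Q)) := by gcongr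
      _ = (ε * (β ^ 2 * ∑ u ∈ F, a u ^ 2)) * Q := by ring
      _ ≤ 1 * Q := by gcongr
      _ = Q := one_mul Q
  have h3 := mul_le_mul_of_nonneg_left h1 hpos'.le
  linarith

theorem col_none_mem_homogenizedCone_lsPlus {Y : Matrix (Option V) (Option V) ℝ}
    (hY : Y ∈ lsPlusLift P) (hpos : 0 < Y none none) :
    Y.col none ∈ homogenizedCone (lsPlus P) := by
  obtain ⟨h1, h2, h3⟩ := hY
  have hinv : 0 ≤ (Y none none)⁻¹ := by positivity
  refine ⟨_, hpos.le, fun i => (Y none none)⁻¹ * Y (some i) none,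
    ⟨(Y none none)⁻¹ • Y, ⟨h1.smul hinv, ?_, fun i => ⟨?_, ?_⟩⟩, ?_, fun i => rfl⟩, rfl, fun i => ?_⟩
  · funext a
    have := congrFun h2 a
    simp only [Matrix.col_apply, Matrix.diag_apply] at this
    simp [this]
  · exact smul_mem_homogenizedCone (h3 i).1 hinv
  · convert smul_mem_homogenizedCone (h3 i).2 hinv using 1
    funext a
    simp [Matrix.col_apply, mul_sub]
  · simp [Matrix.col_apply, hpos.ne']
  · simp [Matrix.col_apply, hpos.ne']

/-- The tangent direction `-y` of the cone of `P` at a set `F` of `0/1` points persists in the cone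
of `LS₊(P)` if it is available on the relevant faces of `F`. -/
theorem exists_mem_homogenizedCone_lsPlus [Finite V] (hP : Convex ℝ P)
    {F : Set (Option V → ℝ)} (hfin : F.Finite) (hne : F.Nonempty)
    (hF : ∀ u ∈ F, u ∈ homogenizedCone P) (hF1 : ∀ u ∈ F, u none = 1)
    (hF01 : ∀ u ∈ F, ∀ v, u v = 0 ∨ u v = 1) {x y : Option V → ℝ}
    (hx : x ∈ homogenizedCone P) (hx1 : x none = 1) (hx01 : ∀ v, x v = 0 ∨ x v = 1)
    (hy1 : y none = 1) {β : ℝ} (hβ : 2 ≤ β) (hxy : x - β • y ∈ Submodule.span ℝ F)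
    (h : ∀ v, (y (some v) = 0 ∧ x (some v) = 0 ∧
        ∃ c ∈ homogenizedCone P, c + y ∈ Submodule.span ℝ {u ∈ F | u (some v) = 0}) ∨
      (y (some v) = 1 ∧
        ∃ c ∈ homogenizedCone P, c + y ∈ Submodule.span ℝ {u ∈ F | u (some v) = 1})) :
    ∃ c ∈ homogenizedCone (lsPlus P), c + y ∈ Submodule.span ℝ F := by
  classical
  have := Fintype.ofFinite V
  lift F to Finset (Option V → ℝ) using hfin
  have hPne : P.Nonempty := by
    obtain ⟨u, hu⟩ := hne
    obtain ⟨t, ht, p, hp, -⟩ := hF u hu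
    exact ⟨p, hp⟩
  have h0 : (0 : Option V → ℝ) ∈ homogenizedCone P := zero_mem_homogenizedCone hPne
  -- The first column then perturbs by x - g y = (x - β y) - y, that is, by -y modulo the span of
  -- `F`; and g + 1 ≤ β² holds because β ≥ 2.
  set g := β + 1 with hg
  set Y : ℝ → Matrix (Option V) (Option V) ℝ := fun ε => ∑ u ∈ F, Matrix.vecMulVec u u +
      ε • (Matrix.vecMulVec x x - g • Matrix.vecMulVec y y) with hY
  have hcol : ∀ ε a, (Y ε).col a = ∑ u ∈ F with u a = 1, u + ε • (x a • x - (g * y a) • y) := by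
    intro ε a
    have : ∑ u ∈ F with u a = 1, u = ∑ u ∈ F, u a • u := by
      rw [Finset.sum_filter]
      refine Finset.sum_congr rfl fun u hu => ?_
      rcases hF01 u hu a with h | h <;> simp [h]
    rw [this]
    funext b
    simp [hY, Matrix.vecMulVec, Matrix.sum_apply, Matrix.col_apply, mul_comm, mul_assoc]
    exact Or.inl (by ring)
  have hcol0 : ∀ ε, (Y ε).col none = ∑ u ∈ F, u + ε • (x - g • y) := by
    intro ε
    rw [hcol, hx1, hy1, mul_one, one_smul, Finset.filter_true_of_mem hF1]
  have hcolsub : ∀ ε a, (Y ε).col none - (Y ε).col a =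
      ∑ u ∈ F with u a = 0, u + ε • ((1 - x a) • x - (g * (1 - y a)) • y) := by
    intro ε a
    have : ∑ u ∈ F, u = ∑ u ∈ F with u a = 1, u + ∑ u ∈ F with u a = 0, u := by
      rw [← Finset.sum_filter_add_sum_filter_not F (fun u => u a = 1)]
      congr 1
      refine Finset.sum_congr (Finset.filter_congr fun u hu => ?_) fun _ _ => rfl
      rcases hF01 u hu a with h | h <;> simp [h]
    rw [hcol0, hcol, this, mul_sub, sub_smul, sub_smul, one_smul, mul_one, smul_sub, smul_sub,
      smul_sub, smul_sub, smul_sub]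
    abel
  have hsub : ∀ (p : (Option V → ℝ) → Prop) [DecidablePred p],
      ∀ u ∈ F.filter p, u ∈ homogenizedCone P := fun p _ u hu => hF u (Finset.mem_filter.1 hu).1
  have hxs : ∀ a, 0 ≤ x a ∧ 0 ≤ 1 - x a := by
    intro a
    rcases hx01 a with h | h <;> simp [h]
  have hcone : ∀ v, ∀ᶠ ε in 𝓝[>] (0 : ℝ), (Y ε).col (some v) ∈ homogenizedCone P ∧
      (Y ε).col none - (Y ε).col (some v) ∈ homogenizedCone P := by
    intro v
    have hgc : ∀ c ∈ homogenizedCone P, ∀ s : ℝ, 0 ≤ s → s • x + g • c ∈ homogenizedCone P :=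
      fun c hc s hs => add_mem_homogenizedCone hP (smul_mem_homogenizedCone hx hs)
        (smul_mem_homogenizedCone hc (by linarith))
    -- The term -g y enters only one of the two columns for `v`: Y(e₀ - e_v) if y_v = 0, and Y e_v
    -- if y_v = 1. There -y is replaced by c minus a vector in the span of the face.
    rcases h v with ⟨hyv, hxv, c, hc, hl⟩ | ⟨hyv, c, hc, hl⟩
    · have e1 := eventually_sum_add_smul_mem_homogenizedCone hP hPne
        (hsub fun u => u (some v) = 1) h0 (Submodule.zero_mem _)
      have e2 := eventually_sum_add_smul_mem_homogenizedCone hP hPne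
        (hsub fun u => u (some v) = 0) (hgc c hc 1 zero_le_one)
        (Submodule.smul_mem _ g (by simpa using hl))
      filter_upwards [e1, e2] with ε h1 h2
      rw [hcolsub, hcol, hyv, hxv]
      refine ⟨by simpa using h1, ?_⟩
      convert h2 using 3
      simp only [sub_zero, mul_one, smul_add]
      abel
    · have e1 := eventually_sum_add_smul_mem_homogenizedCone hP hPne
        (hsub fun u => u (some v) = 1) (hgc c hc (x (some v)) (hxs _).1)
        (Submodule.smul_mem _ g (by simpa using hl))
      have e2 := eventually_sum_add_smul_mem_homogenizedCone hP hPne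
        (hsub fun u => u (some v) = 0)
        (smul_mem_homogenizedCone hx (hxs (some v)).2) (Submodule.zero_mem _)
      filter_upwards [e1, e2] with ε h1 h2
      rw [hcolsub, hcol, hyv]
      refine ⟨?_, by simpa using h2⟩
      convert h1 using 3
      simp only [mul_one, smul_add]
      abel
  have hpsd := eventually_posSemidef (g := g) (by rw [hg]; nlinarith) hxy
  obtain ⟨ε, hε, hεpsd, hε1, hεpos⟩ := ((eventually_all.2 hcone).and (hpsd.and
    ((eventually_mul_le_one (g + 1)).and self_mem_nhdsWithin))).exists
  have hεpos' : 0 < ε := hεpos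
  have h00 : 0 < Y ε none none := by
    have h1 : (Y ε).col none none = F.card + ε * (1 - g) := by
      rw [hcol0]
      simp [hx1, hy1, Finset.sum_congr rfl hF1]
    have h2 : (1 : ℝ) ≤ F.card := by
      exact_mod_cast Finset.card_pos.2 hne
    rw [Matrix.col_apply] at h1
    rw [h1]
    nlinarith
  have hdiag : (Y ε).col none = (Y ε).diag := by
    funext a
    have hsq : ∀ t : ℝ, t = 0 ∨ t = 1 → t * t = t := by rintro t (rfl | rfl) <;> simp
    have hya : y a = 0 ∨ y a = 1 := by
      rcases a with _ | v
      · exact Or.inr hy1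
      · exact (h v).imp And.left And.left
    simp only [hY, Matrix.vecMulVec, Matrix.col_apply, Matrix.diag_apply, Matrix.add_apply,
      Matrix.sum_apply, Matrix.smul_apply, Matrix.sub_apply, Matrix.of_apply, hx1, hy1,
      hsq _ (hx01 a), hsq _ hya, mul_one]
    congr 1
    exact Finset.sum_congr rfl fun u hu => by rw [hF1 u hu, hsq _ (hF01 u hu a), mul_one]
  refine ⟨ε⁻¹ • (Y ε).col none, smul_mem_homogenizedCone
    (col_none_mem_homogenizedCone_lsPlus ⟨hεpsd, hdiag, hε⟩ h00) (by positivity), ?_⟩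
  have e : ε⁻¹ • (Y ε).col none + y = ε⁻¹ • ∑ u ∈ F, u + (x - β • y) := by
    rw [hcol0, smul_add, inv_smul_smul₀ hεpos'.ne', hg, add_smul, one_smul]
    abel
  rw [e]
  exact Submodule.add_mem _ (Submodule.smul_mem _ _ (Submodule.sum_mem _ fun u hu =>
    Submodule.subset_span hu)) hxy

end Perturbation

/-! ### The lower bound for `A_{k,S}` -/

section AGraph

variable {k : ℕ}

/-- The triangle vertex `1`. -/
abbrev tri1 (k : ℕ) : AVertex k := .inl ⟨1, by decide⟩

/-- The triangle vertex `2`. -/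
abbrev tri2 (k : ℕ) : AVertex k := .inl ⟨2, by decide⟩

/-- The triangle vertex `3`. -/
abbrev tri3 (k : ℕ) : AVertex k := .inl ⟨3, by decide⟩

theorem forall_aVertex {p : AVertex k → Prop} :
    (∀ v, p v) ↔ p (tri1 k) ∧ p (tri2 k) ∧ p (tri3 k) ∧
      ∀ i : Finset.Icc 4 k, p (.inr (i, 0)) ∧ p (.inr (i, 1)) ∧ p (.inr (i, 2)) := by
  constructor
  · exact fun h => ⟨h _, h _, h _, fun i => ⟨h _, h _, h _⟩⟩
  · rintro ⟨h1, h2, h3, h⟩ (⟨a, ha⟩ | ⟨i, s⟩)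
    · rw [Finset.mem_Icc] at ha
      obtain ⟨ha1, ha3⟩ := ha
      interval_cases a
      · exact h1
      · exact h2
      · exact h3
    · obtain ⟨h0, h1, h2⟩ := h i
      fin_cases s
      · exact h0
      · exact h1
      · exact h2

theorem sum_aVertex (f : AVertex k → ℝ) :
    ∑ v, f v = f (tri1 k) + f (tri2 k) + f (tri3 k) +
      ∑ i : Finset.Icc 4 k, (f (.inr (i, 0)) + f (.inr (i, 1)) + f (.inr (i, 2))) := by
  rw [Fintype.sum_sum_type, Fintype.sum_prod_type]
  congr 1
  · have : (Finset.univ : Finset (Finset.Icc 1 3)) =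
        {⟨1, by decide⟩, ⟨2, by decide⟩, ⟨3, by decide⟩} := by decide
    rw [this, Finset.sum_insert (by decide), Finset.sum_insert (by decide), Finset.sum_singleton,
      ← add_assoc]
  · exact Finset.sum_congr rfl fun i _ => Fin.sum_univ_three _

/-- The defining inequalities of the fractional stable set polytope of `A_k`. -/
theorem mem_fracPolytope_aGraph {x : AVertex k → ℝ} :
    x ∈ fracPolytope (aGraph k) ↔ (∀ v, 0 ≤ x v ∧ x v ≤ 1) ∧
      (x (tri1 k) + x (tri2 k) ≤ 1 ∧ x (tri1 k) + x (tri3 k) ≤ 1 ∧ x (tri2 k) + x (tri3 k) ≤ 1) ∧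
      (∀ i : Finset.Icc 4 k, x (.inr (i, 0)) + x (.inr (i, 1)) ≤ 1 ∧
        x (.inr (i, 0)) + x (.inr (i, 2)) ≤ 1 ∧ x (.inr (i, 1)) + x (tri2 k) ≤ 1 ∧
        x (.inr (i, 1)) + x (tri3 k) ≤ 1 ∧ x (.inr (i, 2)) + x (tri1 k) ≤ 1) ∧
      ∀ i j : Finset.Icc 4 k, i < j → x (.inr (i, 2)) + x (.inr (j, 1)) ≤ 1 := by
  constructor
  · rintro ⟨h, h'⟩
    refine ⟨h, ⟨h' _ _ ?_, h' _ _ ?_, h' _ _ ?_⟩, fun i => ⟨h' _ _ ?_, h' _ _ ?_, h' _ _ ?_,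
      h' _ _ ?_, h' _ _ ?_⟩, fun i j hij => h' _ _ ?_⟩
    case refine_9 => simpa [aGraph, aEdge] using hij
    all_goals simp [aGraph, aEdge]
  · rintro ⟨h, ⟨h12, h13, h23⟩, h4, h5⟩
    refine ⟨h, ?_⟩
    have key : ∀ v w, v ≠ w → aEdge k v w → x v + x w ≤ 1 := by
      rw [forall_aVertex]
      refine ⟨?_, ?_, ?_, fun i => ⟨?_, ?_, ?_⟩⟩ <;> rw [forall_aVertex]
      · simp [aEdge, h12, h13]
      · simp [aEdge, h23, add_comm (x (tri2 k)) (x (tri1 k)), h12]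
      · simp [aEdge, add_comm (x (tri3 k)), h13, h23]
      · obtain ⟨h0, h0', -⟩ := h4 i
        refine ⟨by simp [aEdge], by simp [aEdge], by simp [aEdge],
          fun j => ⟨by simp [aEdge], fun _ h => ?_, fun _ h => ?_⟩⟩
        · obtain rfl : i = j := by simpa [aEdge] using h
          exact h0
        · obtain rfl : i = j := by simpa [aEdge] using h
          exact h0'
      · obtain ⟨-, -, h2, h3, -⟩ := h4 i
        simp [aEdge, h2, h3]
      · obtain ⟨-, -, -, -, h1⟩ := h4 i
        refine ⟨fun _ _ => h1, by simp [aEdge], by simp [aEdge],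
          fun j => ⟨by simp [aEdge], fun _ h => h5 i j ?_, by simp [aEdge]⟩⟩
        simpa [aEdge] using h
    rintro v w ⟨hne, hvw | hvw⟩
    · exact key v w hne hvw
    · rw [add_comm]
      exact key w v hne.symm hvw

theorem mem_fracPolytope_aGraphS_full {x : AVertex k → ℝ} :
    x ∈ fracPolytope (aGraphS k (Finset.Icc 4 k)) ↔ x ∈ fracPolytope (aGraph k) ∧
      ∀ i : Finset.Icc 4 k, x (.inr (i, 2)) + x (tri2 k) ≤ 1 := by
  constructor
  · rintro ⟨h, h'⟩
    refine ⟨⟨h, fun v w hvw => h' v w (Or.inl hvw)⟩, fun i => h' _ _ (Or.inr ?_)⟩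
    simp [aExtraEdge]
  · rintro ⟨⟨h, h'⟩, h2⟩
    refine ⟨h, fun v w hvw => ?_⟩
    have key : ∀ v w, aExtraEdge k (Finset.Icc 4 k) v w → x v + x w ≤ 1 := by
      rw [forall_aVertex]
      refine ⟨?_, ?_, ?_, fun i => ⟨?_, ?_, ?_⟩⟩ <;> rw [forall_aVertex] <;>
        simp [aExtraEdge, h2]
    rcases hvw with hvw | ⟨hne, hvw | hvw⟩
    · exact h' v w hvw
    · exact key v w hvw
    · rw [add_comm]
      exact key w v hvw

/-- The inequality `∑ x_v ≤ k - 2` holds for the stable sets of `A_k`. -/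
theorem sum_le_of_mem_integerHull_aGraph {x : AVertex k → ℝ}
    (hx : x ∈ integerHull (fracPolytope (aGraph k))) :
    ∑ v, x v ≤ Fintype.card (Finset.Icc 4 k) + 1 := by
  have hc : Convex ℝ {x : AVertex k → ℝ | ∑ v, x v ≤ Fintype.card (Finset.Icc 4 k) + 1} := by
    refine convex_halfSpace_le (𝕜 := ℝ) (f := fun z : AVertex k → ℝ => ∑ v, z v) ⟨?_, ?_⟩ _
    · intro z z'
      simp [Finset.sum_add_distrib]
    · intro c z
      simp only [Pi.smul_apply, smul_eq_mul, Finset.mul_sum]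
  refine convexHull_min (fun x hx => ?_) hc hx
  obtain ⟨hx, h01⟩ := hx
  obtain ⟨hb, ⟨h12, h13, h23⟩, h4, h5⟩ := mem_fracPolytope_aGraph.1 hx
  change ∑ v, x v ≤ _
  rw [sum_aVertex]
  have htri : x (tri1 k) + x (tri2 k) + x (tri3 k) ≤ 1 := by
    rcases h01 (tri1 k) with h1 | h1 <;> rcases h01 (tri2 k) with h2 | h2 <;>
      rcases h01 (tri3 k) with h3 | h3 <;> linarith
  -- If m₁ and m₂ are both chosen, they exclude the whole triangle, as well as i₂ for i < m and i₁
  -- for i > m, so no other triple contributes more than 1. Otherwise the triangle and every triple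
  -- contribute at most 1 each.
  by_cases hm : ∃ m : Finset.Icc 4 k, x (.inr (m, 1)) = 1 ∧ x (.inr (m, 2)) = 1
  · obtain ⟨m, hm1, hm2⟩ := hm
    obtain ⟨hm3, -, hm5, hm6, hm7⟩ := h4 m
    have hle : ∀ i : Finset.Icc 4 k, x (.inr (i, 0)) + x (.inr (i, 1)) + x (.inr (i, 2)) ≤
        1 + if i = m then 1 else 0 := by
      intro i
      obtain ⟨h0, h0', -⟩ := h4 i
      have hb0 := hb (.inr (i, 0))
      have hb1 := hb (.inr (i, 1))
      have hb2 := hb (.inr (i, 2))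
      rcases lt_trichotomy i m with h | h | h
      · have := h5 i m h
        rw [if_neg h.ne]
        linarith
      · subst h
        rw [if_pos rfl]
        linarith
      · have := h5 m i h
        rw [if_neg h.ne']
        linarith
    have := Finset.sum_le_sum fun i (_ : i ∈ Finset.univ) => hle i
    have e : ∑ i : Finset.Icc 4 k, ((1 : ℝ) + if i = m then 1 else 0) =
        Fintype.card (Finset.Icc 4 k) + 1 := by
      rw [Finset.sum_add_distrib, Finset.sum_ite_eq' Finset.univ m, if_pos (Finset.mem_univ m)]
      simp
    linarith
  · have hle : ∀ i : Finset.Icc 4 k,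
        x (.inr (i, 0)) + x (.inr (i, 1)) + x (.inr (i, 2)) ≤ 1 := by
      intro i
      obtain ⟨h0, h0', -⟩ := h4 i
      rcases h01 (.inr (i, 1)) with h1 | h1
      · linarith
      · rcases h01 (.inr (i, 2)) with h2 | h2
        · linarith
        · exact absurd ⟨i, h1, h2⟩ hm
    have := Finset.sum_le_sum fun i (_ : i ∈ Finset.univ) => hle i
    simp only [Finset.sum_const, Finset.card_univ, nsmul_eq_mul, mul_one] at this
    linarith

/-- The excess of a homogenized point over the inequality `∑ x_v ≤ k - 2`. -/
def aExcess (k : ℕ) : (Option (AVertex k) → ℝ) →ₗ[ℝ] ℝ :=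
  ∑ v, LinearMap.proj (some v) - ((Fintype.card (Finset.Icc 4 k) : ℝ) + 1) • LinearMap.proj none

theorem aExcess_apply (u : Option (AVertex k) → ℝ) : aExcess k u =
    ∑ v, u (some v) - (Fintype.card (Finset.Icc 4 k) + 1) * u none := by
  simp [aExcess]

/-- A vector given by its homogenizing coordinate, its coordinates at the triangle and at the
remaining vertices. -/
def aVec (n a b c : ℝ) (z : Finset.Icc 4 k → Fin 3 → ℝ) : Option (AVertex k) → ℝ
  | none => n
  | some (.inl v) => if (v : ℕ) = 1 then a else if (v : ℕ) = 2 then b else c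
  | some (.inr (i, s)) => z i s

section aVec

variable (n a b c : ℝ) (z : Finset.Icc 4 k → Fin 3 → ℝ)

@[simp] theorem aVec_none : aVec n a b c z none = n := rfl

@[simp] theorem aVec_tri1 : aVec n a b c z (some (tri1 k)) = a := by simp [aVec]

@[simp] theorem aVec_tri2 : aVec n a b c z (some (tri2 k)) = b := by simp [aVec]

@[simp] theorem aVec_tri3 : aVec n a b c z (some (tri3 k)) = c := by simp [aVec]

@[simp] theorem aVec_inr (i : Finset.Icc 4 k) (s : Fin 3) :
    aVec n a b c z (some (.inr (i, s))) = z i s := rfl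

end aVec

theorem aVec_ext {u w : Option (AVertex k) → ℝ} (h0 : u none = w none)
    (h1 : u (some (tri1 k)) = w (some (tri1 k))) (h2 : u (some (tri2 k)) = w (some (tri2 k)))
    (h3 : u (some (tri3 k)) = w (some (tri3 k)))
    (h : ∀ i, u (some (.inr (i, 0))) = w (some (.inr (i, 0))) ∧
      u (some (.inr (i, 1))) = w (some (.inr (i, 1))) ∧
      u (some (.inr (i, 2))) = w (some (.inr (i, 2)))) : u = w := by
  funext a
  rcases a with _ | v
  · exact h0
  · exact forall_aVertex (p := fun v => u (some v) = w (some v)).2 ⟨h1, h2, h3, h⟩ v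

/-- The homogenized stable sets of `A_{k,S}`, `S = {4, …, k}`, attaining equality in
`∑ x_v ≤ k - 2` and containing `i₀` for all `i ∉ I`. -/
def tightSet (I : Finset (Finset.Icc 4 k)) : Set (Option (AVertex k) → ℝ) :=
  {u | u none = 1 ∧ (∀ v, u (some v) = 0 ∨ u (some v) = 1) ∧
    (fun v => u (some v)) ∈ fracPolytope (aGraphS k (Finset.Icc 4 k)) ∧ aExcess k u = 0 ∧
    ∀ i ∉ I, u (some (.inr (i, 0))) = 1}

theorem tightSet_mono {I J : Finset (Finset.Icc 4 k)} (h : I ⊆ J) : tightSet I ⊆ tightSet J :=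
  fun _ hu => ⟨hu.1, hu.2.1, hu.2.2.1, hu.2.2.2.1, fun i hi => hu.2.2.2.2 i fun hi' => hi (h hi')⟩

theorem finite_tightSet (I : Finset (Finset.Icc 4 k)) : (tightSet I).Finite := by
  refine finite_zero_one.subset fun u hu v => ?_
  rcases v with _ | v
  · exact Or.inr hu.1
  · exact hu.2.1 v

/-- The homogenized stable set `{i₀ : i}`. -/
def centerVec (k : ℕ) : Option (AVertex k) → ℝ := aVec 1 0 0 0 fun _ => ![1, 0, 0]

/-- The homogenized stable set `{i₀ : i ∉ I}`. -/
def outerVec (I : Finset (Finset.Icc 4 k)) : Option (AVertex k) → ℝ :=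
  aVec 1 0 0 0 fun i => if i ∈ I then ![0, 0, 0] else ![1, 0, 0]

theorem tri_mem_tightSet (I : Finset (Finset.Icc 4 k)) {a b c : ℝ}
    (h : (a = 1 ∧ b = 0 ∧ c = 0) ∨ (a = 0 ∧ b = 1 ∧ c = 0) ∨ (a = 0 ∧ b = 0 ∧ c = 1)) :
    aVec 1 a b c (fun _ => ![1, 0, 0]) ∈ tightSet I := by
  refine ⟨rfl, ?_, ?_, ?_, ?_⟩
  · rw [forall_aVertex]
    rcases h with ⟨rfl, rfl, rfl⟩ | ⟨rfl, rfl, rfl⟩ | ⟨rfl, rfl, rfl⟩ <;> simp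
  · rw [mem_fracPolytope_aGraphS_full, mem_fracPolytope_aGraph, forall_aVertex]
    rcases h with ⟨rfl, rfl, rfl⟩ | ⟨rfl, rfl, rfl⟩ | ⟨rfl, rfl, rfl⟩ <;> simp
  · rw [aExcess_apply, sum_aVertex]
    rcases h with ⟨rfl, rfl, rfl⟩ | ⟨rfl, rfl, rfl⟩ | ⟨rfl, rfl, rfl⟩ <;> simp [add_comm]
  · simp

/-- Replacing m₀ by one of {1, m₁}, {3, m₂}, {m₁, m₂} keeps the other i₀ and gives a tight stable
set. -/
theorem flip_mem_tightSet {I : Finset (Finset.Icc 4 k)} {m : Finset.Icc 4 k} (hm : m ∈ I)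
    {a c p q : ℝ} (h : (a = 1 ∧ c = 0 ∧ p = 1 ∧ q = 0) ∨ (a = 0 ∧ c = 1 ∧ p = 0 ∧ q = 1) ∨
      (a = 0 ∧ c = 0 ∧ p = 1 ∧ q = 1)) :
    aVec 1 a 0 c (fun i => if i = m then ![0, p, q] else ![1, 0, 0]) ∈ tightSet I := by
  refine ⟨rfl, ?_, ?_, ?_, ?_⟩
  · rw [forall_aVertex]
    refine ⟨?_, ?_, ?_, fun i => ?_⟩ <;>
      rcases h with ⟨rfl, rfl, rfl, rfl⟩ | ⟨rfl, rfl, rfl, rfl⟩ | ⟨rfl, rfl, rfl, rfl⟩ <;>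
      simp <;> by_cases hi : i = m <;> simp [hi]
  · rw [mem_fracPolytope_aGraphS_full, mem_fracPolytope_aGraph, forall_aVertex]
    refine ⟨⟨⟨?_, ?_, ?_, fun i => ?_⟩, ?_, fun i => ?_, fun i j hij => ?_⟩, fun i => ?_⟩
    case refine_2.refine_7 =>
      by_cases hi : i = m
      · subst hi
        rcases h with ⟨rfl, rfl, rfl, rfl⟩ | ⟨rfl, rfl, rfl, rfl⟩ | ⟨rfl, rfl, rfl, rfl⟩ <;>
          simp [hij.ne']
      · by_cases hj : j = m <;>
        rcases h with ⟨rfl, rfl, rfl, rfl⟩ | ⟨rfl, rfl, rfl, rfl⟩ | ⟨rfl, rfl, rfl, rfl⟩ <;>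
          simp [hi, hj]
    all_goals
      rcases h with ⟨rfl, rfl, rfl, rfl⟩ | ⟨rfl, rfl, rfl, rfl⟩ | ⟨rfl, rfl, rfl, rfl⟩ <;>
      simp <;> by_cases hi : i = m <;> simp [hi]
  · rw [aExcess_apply, sum_aVertex]
    have : ∀ i : Finset.Icc 4 k,
        (if i = m then ![0, p, q] else ![1, 0, 0]) 0 + (if i = m then ![0, p, q] else ![1, 0, 0]) 1 +
        (if i = m then ![0, p, q] else ![1, 0, 0]) 2 = 1 + if i = m then p + q - 1 else 0 := by
      intro i
      by_cases hi : i = m <;> simp [hi]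
    simp only [aVec_tri1, aVec_tri2, aVec_tri3, aVec_inr, aVec_none, this]
    rw [Finset.sum_add_distrib, Finset.sum_ite_eq' Finset.univ m, if_pos (Finset.mem_univ m)]
    simp only [Finset.sum_const, Finset.card_univ, nsmul_eq_mul, mul_one]
    rcases h with ⟨rfl, rfl, rfl, rfl⟩ | ⟨rfl, rfl, rfl, rfl⟩ | ⟨rfl, rfl, rfl, rfl⟩ <;> ring
  · intro i hi
    have : i ≠ m := fun h => hi (h ▸ hm)
    simp [this]

/-- For each m ∈ I, an alternating sum of five tight sets cancels everything at 1, 3, m₁ and m₂ and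
leaves the center vector plus the unit vector at m₀. Summing over I gives the relation, with β = |I|
+ 1. -/
theorem outerVec_sub_smul_centerVec_mem_span (I : Finset (Finset.Icc 4 k)) :
    outerVec I - ((I.card : ℝ) + 1) • centerVec k ∈ Submodule.span ℝ (tightSet I) := by
  set g : Finset.Icc 4 k → Option (AVertex k) → ℝ := fun m =>
    aVec 1 0 0 0 (fun i => if i = m then ![0, 1, 1] else ![1, 0, 0])
      - aVec 1 1 0 0 (fun i => if i = m then ![0, 1, 0] else ![1, 0, 0])
      + aVec 1 1 0 0 (fun _ => ![1, 0, 0])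
      - aVec 1 0 0 1 (fun i => if i = m then ![0, 0, 1] else ![1, 0, 0])
      + aVec 1 0 0 1 (fun _ => ![1, 0, 0]) with hg
  have hgval : ∀ m, g m = aVec 1 0 0 0 fun i => ![1 + if i = m then 1 else 0, 0, 0] := by
    intro m
    refine aVec_ext ?_ ?_ ?_ ?_ fun i => ?_
    case refine_5 => by_cases hi : i = m <;> simp [hg, hi]
    all_goals simp [hg]
  have hgmem : ∀ m ∈ I, g m ∈ Submodule.span ℝ (tightSet I) := by
    intro m hm
    refine Submodule.add_mem _ (Submodule.sub_mem _ (Submodule.add_mem _ (Submodule.sub_mem _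
      ?_ ?_) ?_) ?_) ?_ <;> apply Submodule.subset_span
    · exact flip_mem_tightSet hm (by simp)
    · exact flip_mem_tightSet hm (by simp)
    · exact tri_mem_tightSet I (by simp)
    · exact flip_mem_tightSet hm (by simp)
    · exact tri_mem_tightSet I (by simp)
  have : outerVec I - ((I.card : ℝ) + 1) • centerVec k = -∑ m ∈ I, g m := by
    simp only [hgval]
    refine aVec_ext ?_ ?_ ?_ ?_ fun i => ?_
    case refine_5 =>
      by_cases hi : i ∈ I <;> simp [outerVec, centerVec, hi, Finset.sum_add_distrib]
    all_goals simp [outerVec, centerVec]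
  rw [this]
  exact Submodule.neg_mem _ (Submodule.sum_mem _ hgmem)

end AGraph

section AGraphLowerBound

open Literal

variable {k : ℕ}

theorem homSubst_eq_subst {V W : Type*} (f : W → Literal V) {u : Option V → ℝ} (hu : u none = 1) :
    (fun w => homSubst f u (some w)) = subst f fun v => u (some v) := by
  funext w
  cases h : f w <;> simp [subst, h, homEval, eval, hu]

/-- The substitution letting the stretched vertex `m` play the role of the triangle vertex `t`,
which is deleted, and putting `i₀ = 1` for all other `i ∉ J`. -/
def collapse (t : AVertex k) (m : Finset.Icc 4 k) (J : Finset (Finset.Icc 4 k)) :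
    AVertex k → Literal (AVertex k)
  | .inl v => if .inl v = t then zero else pos (.inl v)
  | .inr (i, s) => if i = m then (if s = 0 then neg t else pos t) else
      if i ∈ J then pos (.inr (i, s)) else if s = 0 then one else zero

/-- Both m₁ and m₂ receive x_t, so their remaining neighbours must be neighbours of t. For t = 1 no
j₁ may be adjacent to m₂, so m lies above J; for t = 3 no i₂ may be adjacent to m₁, so m lies below
J; for t = 2 every i₁ and i₂ is a neighbour of t because all extra edges are present. -/
theorem subst_collapse_mem_fracPolytope {t : AVertex k} {m : Finset.Icc 4 k}
    {J : Finset (Finset.Icc 4 k)} (hm : m ∉ J)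
    (ht : (t = tri1 k ∧ ∀ i ∈ J, i < m) ∨ t = tri2 k ∨ (t = tri3 k ∧ ∀ i ∈ J, m < i))
    {x : AVertex k → ℝ} (hx : x ∈ fracPolytope (aGraphS k (Finset.Icc 4 k))) :
    subst (collapse t m J) x ∈ fracPolytope (aGraphS k (Finset.Icc 4 k)) := by
  rw [mem_fracPolytope_aGraphS_full, mem_fracPolytope_aGraph] at hx ⊢
  obtain ⟨⟨hb, ⟨h12, h13, h23⟩, h4, h5⟩, h6⟩ := hx
  have hbt := hb t
  have b1 := hb (tri1 k)
  have b2 := hb (tri2 k)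
  have b3 := hb (tri3 k)
  have hval : ∀ i s, subst (collapse t m J) x (.inr (i, s)) =
      if i = m then (if s = 0 then 1 - x t else x t) else
        if i ∈ J then x (.inr (i, s)) else if s = 0 then 1 else 0 := by
    intro i s
    simp only [subst, collapse]
    split_ifs <;> rfl
  have htri : ∀ v, subst (collapse t m J) x (.inl v) = if .inl v = t then 0 else x (.inl v) := by
    intro v
    simp only [subst, collapse]
    split_ifs <;> rfl
  have htri0 : ∀ v, 0 ≤ subst (collapse t m J) x (.inl v) ∧
      subst (collapse t m J) x (.inl v) ≤ x (.inl v) := by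
    intro v
    rw [htri]
    have := (hb (.inl v)).1
    split_ifs <;> simp [this]
  have htt : ∀ v, x t + subst (collapse t m J) x (.inl v) ≤ 1 := by
    intro v
    have h12' := (add_comm _ _).trans_le h12
    have h13' := (add_comm _ _).trans_le h13
    have h23' := (add_comm _ _).trans_le h23
    have hne : ∀ v : AVertex k, v ≠ t → (v = tri1 k ∨ v = tri2 k ∨ v = tri3 k) → x t + x v ≤ 1 := by
      have ht' : t = tri1 k ∨ t = tri2 k ∨ t = tri3 k := by tauto
      rintro v hv (rfl | rfl | rfl) <;> rcases ht' with rfl | rfl | rfl <;>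
        first | exact absurd rfl hv | assumption
    rw [htri]
    split_ifs with h
    · linarith
    · refine hne _ h ?_
      obtain ⟨a, ha⟩ := v
      rw [Finset.mem_Icc] at ha
      obtain ⟨ha1, ha3⟩ := ha
      interval_cases a <;> simp
  have c1 := htri0 ⟨1, by decide⟩
  have c2 := htri0 ⟨2, by decide⟩
  have c3 := htri0 ⟨3, by decide⟩
  refine ⟨⟨forall_aVertex.2 ⟨⟨c1.1, c1.2.trans b1.2⟩, ⟨c2.1, c2.2.trans b2.2⟩,
    ⟨c3.1, c3.2.trans b3.2⟩, fun i => ?_⟩, ⟨?_, ?_, ?_⟩, fun i => ?_, fun i j hij => ?_⟩,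
    fun i => ?_⟩
  · have d0 := hb (.inr (i, 0))
    have d1 := hb (.inr (i, 1))
    have d2 := hb (.inr (i, 2))
    simp only [hval]
    split_ifs <;> refine ⟨⟨?_, ?_⟩, ⟨?_, ?_⟩, ⟨?_, ?_⟩⟩ <;> linarith
  · linarith
  · linarith
  · linarith
  · obtain ⟨e1, e2, e3, e4, e5⟩ := h4 i
    have f1 := htt ⟨1, by decide⟩
    have f2 := htt ⟨2, by decide⟩
    have f3 := htt ⟨3, by decide⟩
    by_cases him : i = m
    · simp [hval, him, f1, f2, f3]
    · by_cases hi : i ∈ J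
      · simp only [hval, him, hi, if_true, if_false]
        exact ⟨e1, e2, by linarith, by linarith, by linarith⟩
      · simp [hval, him, hi]
        exact ⟨by linarith, by linarith, by linarith⟩
  · have d1 := hb (.inr (i, 2))
    have d2 := hb (.inr (j, 1))
    by_cases him : i = m
    · subst him
      by_cases hj : j ∈ J
      · have : x t + x (.inr (j, 1)) ≤ 1 := by
          obtain ⟨-, -, e3, e4, -⟩ := h4 j
          rcases ht with ⟨rfl, h⟩ | rfl | ⟨rfl, -⟩
          · exact absurd (h j hj) hij.not_gt
          · linarith
          · linarith
        simpa [hval, hij.ne', hj] using this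
      · simpa [hval, hij.ne', hj] using hbt.2
    · by_cases hjm : j = m
      · subst hjm
        by_cases hi : i ∈ J
        · have : x (.inr (i, 2)) + x t ≤ 1 := by
            obtain ⟨-, -, -, -, e5⟩ := h4 i
            rcases ht with ⟨rfl, -⟩ | rfl | ⟨rfl, h⟩
            · exact e5
            · exact h6 i
            · exact absurd (h i hi) hij.not_gt
          simpa [hval, him, hi] using this
        · simpa [hval, him, hi] using hbt.2
      · have := h5 i j hij
        simp only [hval, him, hjm, if_false]
        split_ifs <;> first | linarith | simp at *
  · have f2 := htt ⟨2, by decide⟩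
    have := h6 i
    by_cases him : i = m
    · simpa [hval, him] using f2
    · by_cases hi : i ∈ J
      · simp only [hval, him, hi, if_true, if_false]
        linarith
      · simp [hval, him, hi]
        linarith

theorem homSubst_collapse_mem_tightSet {t : AVertex k} {m : Finset.Icc 4 k}
    {J : Finset (Finset.Icc 4 k)} (hm : m ∉ J)
    (ht : (t = tri1 k ∧ ∀ i ∈ J, i < m) ∨ t = tri2 k ∨ (t = tri3 k ∧ ∀ i ∈ J, m < i))
    {u : Option (AVertex k) → ℝ} (hu : u ∈ tightSet J) :
    homSubst (collapse t m J) u ∈ tightSet (insert m J) ∧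
      homSubst (collapse t m J) u (some t) = 0 := by
  have ht' : t = tri1 k ∨ t = tri2 k ∨ t = tri3 k := by tauto
  obtain ⟨h1, h01, hfrac, hex, hJ⟩ := hu
  refine ⟨⟨h1, fun v => ?_, ?_, ?_, fun i hi => ?_⟩, ?_⟩
  · have := homSubst_eq_subst (collapse t m J) h1
    rw [homSubst_some]
    cases h : collapse t m J v with
    | zero => exact Or.inl rfl
    | one => exact Or.inr h1
    | pos w => exact h01 w
    | neg w => rcases h01 w with h | h <;> simp [homEval, h1, h]
  · rw [homSubst_eq_subst _ h1]
    exact subst_collapse_mem_fracPolytope hm ht hfrac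
  · have hz : ∀ i ∉ J, u (some (.inr (i, 1))) = 0 ∧ u (some (.inr (i, 2))) = 0 := by
      intro i hi
      obtain ⟨⟨hb, -, h4, -⟩, -⟩ := mem_fracPolytope_aGraphS_full.1 hfrac |>.imp_left
        mem_fracPolytope_aGraph.1
      obtain ⟨h0, h0', -⟩ := h4 i
      have b1 := (hb (.inr (i, 1))).1
      have b2 := (hb (.inr (i, 2))).1
      have := hJ i hi
      constructor <;> linarith
    -- The triple at `m` changes from (1, 0, 0) to (1 - u_t, u_t, u_t) and gains u_t, which
    -- compensates for the deletion of `t`; so tightness is preserved.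
    have htriple : ∀ i, homSubst (collapse t m J) u (some (.inr (i, 0))) +
        homSubst (collapse t m J) u (some (.inr (i, 1))) +
        homSubst (collapse t m J) u (some (.inr (i, 2))) =
        u (some (.inr (i, 0))) + u (some (.inr (i, 1))) + u (some (.inr (i, 2))) +
          if i = m then u (some t) else 0 := by
      intro i
      by_cases him : i = m
      · subst him
        simp [collapse, homEval, h1, hz i hm, hJ i hm]
      · by_cases hi : i ∈ J
        · simp [collapse, homEval, him, hi]
        · simp [collapse, homEval, him, hi, h1, hz i hi, hJ i hi]
    rw [aExcess_apply, sum_aVertex] at hex ⊢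
    simp only [htriple]
    rw [Finset.sum_add_distrib, Finset.sum_ite_eq' Finset.univ m, if_pos (Finset.mem_univ m)]
    rw [← hex]
    rcases ht' with rfl | rfl | rfl <;> simp [collapse, homEval] <;> ring
  · rw [Finset.mem_insert, not_or] at hi
    simp [collapse, hi.1, hi.2, homEval, h1]
  · rcases ht' with rfl | rfl | rfl <;> simp [collapse, homEval]

theorem homSubst_collapse_centerVec {t : AVertex k} {m : Finset.Icc 4 k}
    {J : Finset (Finset.Icc 4 k)} (ht : t = tri1 k ∨ t = tri2 k ∨ t = tri3 k) :
    homSubst (collapse t m J) (centerVec k) = centerVec k := by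
  have h0 : centerVec k (some t) = 0 := by
    rcases ht with rfl | rfl | rfl <;> simp [centerVec]
  refine aVec_ext rfl ?_ ?_ ?_ fun i => ?_
  case refine_4 =>
    by_cases him : i = m
    · simp [collapse, him, homEval, h0]
      simp [centerVec]
    · by_cases hi : i ∈ J <;> simp [collapse, him, hi, homEval, centerVec]
  all_goals
    rcases ht with rfl | rfl | rfl <;> simp [collapse, homEval, centerVec]

/-- The direction -y, with y the center vector, survives one application of LS₊ for each stretched
vertex in I. The induction spends one m ∈ I per application, choosing m according to the coordinate
under consideration. -/
theorem exists_add_centerVec_mem_span_tightSet (n : ℕ) : ∀ I : Finset (Finset.Icc 4 k),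
    I.card = n → ∃ c ∈ homogenizedCone (lsPlus^[n] (fracPolytope (aGraphS k (Finset.Icc 4 k)))),
      c + centerVec k ∈ Submodule.span ℝ (tightSet I) := by
  set G := aGraphS k (Finset.Icc 4 k) with hG
  induction n with
  | zero =>
    intro I hI
    -- Twice the point with value 1/2 on the triangle and 1 at every i₀; adding the center vector
    -- gives the sum of the three tight sets made of one triangle vertex and all i₀.
    refine ⟨aVec 2 1 1 1 fun _ => ![2, 0, 0], ⟨2, zero_le_two,
      fun v => (1 / 2) * aVec 2 1 1 1 (fun _ => ![2, 0, 0]) (some v), ?_, rfl, fun v => by ring⟩, ?_⟩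
    · rw [Function.iterate_zero, id, mem_fracPolytope_aGraphS_full, mem_fracPolytope_aGraph,
        forall_aVertex]
      simp
      norm_num
    · have : aVec 2 1 1 1 (fun _ => ![2, 0, 0]) + centerVec k =
          aVec 1 1 0 0 (fun _ => ![1, 0, 0]) + aVec 1 0 1 0 (fun _ => ![1, 0, 0]) +
            aVec 1 0 0 1 (fun _ => ![1, 0, 0]) := by
        refine aVec_ext ?_ ?_ ?_ ?_ fun i => ?_ <;> simp [centerVec] <;> norm_num
      rw [this]
      refine Submodule.add_mem _ (Submodule.add_mem _ ?_ ?_) ?_ <;>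
        exact Submodule.subset_span (tri_mem_tightSet I (by simp))
  | succ n ih =>
    intro I hI
    have hIne : I.Nonempty := Finset.card_pos.1 (by omega)
    have hconv := convex_lsPlus_iterate (convex_fracPolytope G) n
    have herase : ∀ m ∈ I, (I.erase m).card = n := fun m hm => by
      rw [Finset.card_erase_of_mem hm, hI, Nat.add_sub_cancel]
    have hcone : ∀ u : Option (AVertex k) → ℝ, u none = 1 →
        (∀ v, u (some v) = 0 ∨ u (some v) = 1) → (fun v => u (some v)) ∈ fracPolytope G →
        u ∈ homogenizedCone (lsPlus^[n] (fracPolytope G)) := fun u h1 h01 hfrac =>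
      ⟨1, zero_le_one, _, mem_lsPlus_iterate_of_zero_one hfrac h01 n, h1, fun v => by simp⟩
    have hcol : ∀ t m, m ∈ I → ((t = tri1 k ∧ ∀ i ∈ I.erase m, i < m) ∨ t = tri2 k ∨
        (t = tri3 k ∧ ∀ i ∈ I.erase m, m < i)) →
        ∃ c ∈ homogenizedCone (lsPlus^[n] (fracPolytope G)),
          c + centerVec k ∈ Submodule.span ℝ {u ∈ tightSet I | u (some t) = 0} := by
      intro t m hm ht
      have hmJ : m ∉ I.erase m := Finset.notMem_erase m I
      obtain ⟨c, hc, hl⟩ := ih (I.erase m) (herase m hm)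
      refine ⟨homSubst (collapse t m (I.erase m)) c, homSubst_mem_homogenizedCone
        (fun x hx => subst_mem_lsPlus_iterate (convex_fracPolytope G) (zero_mem_fracPolytope G)
          (fun x hx => subst_collapse_mem_fracPolytope hmJ ht hx) n hx) hc, ?_⟩
      have h1 := Submodule.mem_map_of_mem (f := homSubst (collapse t m (I.erase m))) hl
      rw [Submodule.map_span, map_add, homSubst_collapse_centerVec (by tauto)] at h1
      refine Submodule.span_mono ?_ h1
      rintro _ ⟨u, hu, rfl⟩
      have := homSubst_collapse_mem_tightSet hmJ ht hu
      rwa [Finset.insert_erase hm] at this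
    -- Removing `i` itself from `I`, or any element if i ∉ I, already confines the tight sets to the
    -- face u_{i₀} = 1. By `hside` this face also serves the coordinates i₁ and i₂.
    have hnode : ∀ i, ∃ c ∈ homogenizedCone (lsPlus^[n] (fracPolytope G)),
        c + centerVec k ∈ Submodule.span ℝ {u ∈ tightSet I | u (some (.inr (i, 0))) = 1} := by
      intro i
      obtain ⟨m, hm, hi⟩ : ∃ m ∈ I, i ∉ I.erase m := by
        by_cases hi : i ∈ I
        · exact ⟨i, hi, Finset.notMem_erase i I⟩
        · obtain ⟨m, hm⟩ := hIne
          exact ⟨m, hm, fun h => hi (Finset.mem_of_mem_erase h)⟩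
      obtain ⟨c, hc, hl⟩ := ih (I.erase m) (herase m hm)
      refine ⟨c, hc, Submodule.span_mono ?_ hl⟩
      exact fun u hu => ⟨tightSet_mono (Finset.erase_subset m I) hu, hu.2.2.2.2 i hi⟩
    have hside : ∀ i, ∀ u ∈ tightSet I, u (some (.inr (i, 0))) = 1 →
        u (some (.inr (i, 1))) = 0 ∧ u (some (.inr (i, 2))) = 0 := by
      intro i u hu h0
      obtain ⟨hb, -, h4, -⟩ := mem_fracPolytope_aGraph.1
        (mem_fracPolytope_aGraphS_full.1 hu.2.2.1).1
      obtain ⟨h1, h2, -⟩ := h4 i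
      have b1 := (hb (.inr (i, 1))).1
      have b2 := (hb (.inr (i, 2))).1
      constructor <;> linarith
    rw [Function.iterate_succ_apply']
    refine exists_mem_homogenizedCone_lsPlus hconv (finite_tightSet I)
      ⟨_, tri_mem_tightSet I (a := 1) (b := 0) (c := 0) (by simp)⟩
      (fun u hu => hcone u hu.1 hu.2.1 hu.2.2.1) (fun u hu => hu.1) (fun u hu v => ?_)
      (x := outerVec I) (hcone _ rfl ?_ ?_) rfl (fun v => ?_) rfl (β := I.card + 1) ?_
      (outerVec_sub_smul_centerVec_mem_span I) ?_
    · rcases v with _ | v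
      · exact Or.inr hu.1
      · exact hu.2.1 v
    · refine forall_aVertex.2 ⟨?_, ?_, ?_, fun i => ?_⟩
      case refine_4 => by_cases hi : i ∈ I <;> simp [outerVec, hi]
      all_goals simp [outerVec]
    · rw [mem_fracPolytope_aGraphS_full, mem_fracPolytope_aGraph, forall_aVertex]
      refine ⟨⟨⟨?_, ?_, ?_, fun i => ?_⟩, ?_, fun i => ?_, fun i j hij => ?_⟩, fun i => ?_⟩
      case succ.refine_3.refine_7 =>
        by_cases hi : i ∈ I <;> by_cases hj : j ∈ I <;> simp [outerVec, hi, hj]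
      all_goals simp [outerVec] <;> by_cases hi : i ∈ I <;> simp [hi]
    · rcases v with _ | v
      · exact Or.inr rfl
      · revert v
        refine forall_aVertex.2 ⟨?_, ?_, ?_, fun i => ?_⟩
        case refine_4 => by_cases hi : i ∈ I <;> simp [outerVec, hi]
        all_goals simp [outerVec]
    · rw [hI]
      push_cast
      have : (0 : ℝ) ≤ n := n.cast_nonneg
      linarith
    · refine forall_aVertex.2 ⟨Or.inl ⟨?_, ?_, ?_⟩, Or.inl ⟨?_, ?_, ?_⟩, Or.inl ⟨?_, ?_, ?_⟩,
        fun i => ⟨Or.inr ⟨?_, hnode i⟩, Or.inl ⟨?_, ?_, ?_⟩, Or.inl ⟨?_, ?_, ?_⟩⟩⟩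
      · simp [centerVec]
      · simp [outerVec]
      -- The vertex replacing 1 must lie above the rest of `I`; for 3 it must lie below, hence the
      -- minimum there; for 2 any element works.
      · refine hcol _ _ (I.max'_mem hIne) (Or.inl ⟨rfl, fun i hi => ?_⟩)
        exact I.lt_max'_of_mem_erase_max' hIne hi
      · simp [centerVec]
      · simp [outerVec]
      · exact hcol _ _ (I.max'_mem hIne) (Or.inr (Or.inl rfl))
      · simp [centerVec]
      · simp [outerVec]
      · refine hcol _ _ (I.min'_mem hIne) (Or.inr (Or.inr ⟨rfl, fun i hi => ?_⟩))
        exact I.min'_lt_of_mem_erase_min' hIne hi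
      · simp [centerVec]
      · simp [centerVec]
      · by_cases hi : i ∈ I <;> simp [outerVec, hi]
      · obtain ⟨c, hc, hl⟩ := hnode i
        refine ⟨c, hc, Submodule.span_mono ?_ hl⟩
        rintro u ⟨hu, h0⟩
        exact ⟨hu, (hside i u hu h0).1⟩
      · simp [centerVec]
      · by_cases hi : i ∈ I <;> simp [outerVec, hi]
      · obtain ⟨c, hc, hl⟩ := hnode i
        refine ⟨c, hc, Submodule.span_mono ?_ hl⟩
        rintro u ⟨hu, h0⟩
        exact ⟨hu, (hside i u hu h0).2⟩

/-- The inequality `∑ x_v ≤ k - 2` is violated after `k - 3` applications of `LS₊`. -/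
theorem exists_mem_lsPlus_iterate_aGraphS_full (k : ℕ) :
    ∃ x ∈ lsPlus^[Fintype.card (Finset.Icc 4 k)] (fracPolytope (aGraphS k (Finset.Icc 4 k))),
      (Fintype.card (Finset.Icc 4 k) : ℝ) + 1 < ∑ v, x v := by
  obtain ⟨c, ⟨t, ht, x, hx, hc0, hcx⟩, hl⟩ :=
    exists_add_centerVec_mem_span_tightSet (k := k) _ Finset.univ rfl
  have h0 : aExcess k (c + centerVec k) = 0 := by
    have : Submodule.span ℝ (tightSet (k := k) Finset.univ) ≤ LinearMap.ker (aExcess k) :=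
      Submodule.span_le.2 fun u hu => hu.2.2.2.1
    exact this hl
  have h1 : aExcess k (centerVec k) = -1 := by
    rw [aExcess_apply, sum_aVertex]
    simp [centerVec]
  have h2 : aExcess k c = t * (∑ v, x v - (Fintype.card (Finset.Icc 4 k) + 1)) := by
    rw [aExcess_apply]
    simp only [hcx, hc0, mul_sub, Finset.mul_sum]
    ring
  rw [map_add, h1, h2] at h0
  refine ⟨x, hx, ?_⟩
  by_contra! hle
  nlinarith

end AGraphLowerBound

/-! ### Minimality, invariance under isomorphism, and degree sequences. -/

section AGraphDegree

variable {k : ℕ} {S S' : Finset ℕ}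

theorem lsPlus_iterate_ne_integerHull {V : Type*} [Finite V] {G : SimpleGraph V} {n r : ℕ}
    (h : ¬ lsPlus^[n] (fracPolytope G) ⊆ integerHull (fracPolytope G)) (hr : r ≤ n) :
    lsPlus^[r] (fracPolytope G) ≠ integerHull (fracPolytope G) := fun he =>
  h ((lsPlus_iterate_antitone (convex_fracPolytope G) (zero_mem_fracPolytope G) hr).trans he.le)

/-- A graph on `3 (n + 1)` vertices for which `n` applications of `LS₊` do not suffice is
`(n + 1)`-minimal. -/
theorem isLMinimal_of_not_subset {V : Type*} [Fintype V] {G : SimpleGraph V} {n : ℕ}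
    (hV : Fintype.card V = 3 * (n + 1))
    (h : ¬ lsPlus^[n] (fracPolytope G) ⊆ integerHull (fracPolytope G)) :
    IsLMinimal (n + 1) G := by
  refine ⟨⟨?_, fun r hr => ?_⟩, hV⟩
  · have := lsPlus_iterate_subset_integerHull _ G hV
    rw [Nat.mul_div_cancel_left _ (by norm_num)] at this
    exact this.antisymm (integerHull_subset_lsPlus_iterate (convex_fracPolytope G) _)
  · by_contra! hlt
    exact lsPlus_iterate_ne_integerHull h (Nat.lt_succ_iff.1 hlt) hr

theorem lsPlus_iterate_eq_integerHull_of_iso {V W : Type*} [Finite V] [Finite W]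
    {G : SimpleGraph V} {H : SimpleGraph W} (e : G ≃g H) {r : ℕ}
    (h : lsPlus^[r] (fracPolytope G) = integerHull (fracPolytope G)) :
    lsPlus^[r] (fracPolytope H) = integerHull (fracPolytope H) := by
  refine Set.Subset.antisymm (fun x hx => ?_)
    (integerHull_subset_lsPlus_iterate (convex_fracPolytope H) _)
  have h1 := Literal.subst_mem_lsPlus_iterate (f := fun v => Literal.pos (e v))
    (Q := fracPolytope G) (convex_fracPolytope H) (zero_mem_fracPolytope H)
    (fun z hz => ⟨fun i => hz.1 _, fun i j hij => hz.2 _ _ (e.map_adj_iff.2 hij)⟩) r hx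
  rw [h] at h1
  have h2 := Literal.subst_mem_integerHull (f := fun w => Literal.pos (e.symm w))
    (Q := fracPolytope H)
    (fun z hz => ⟨fun i => hz.1 _, fun i j hij => hz.2 _ _ (e.symm.map_adj_iff.2 hij)⟩) h1
  refine Set.mem_of_eq_of_mem (funext fun w => ?_) h2
  simp [Literal.subst, Literal.eval]

theorem IsLMinimal.iso {V W : Type*} [Fintype V] [Fintype W] {G : SimpleGraph V}
    {H : SimpleGraph W} {n : ℕ} (hG : IsLMinimal n G) (e : G ≃g H) : IsLMinimal n H := by
  refine ⟨⟨lsPlus_iterate_eq_integerHull_of_iso e hG.1.1,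
    fun r hr => hG.1.2 (lsPlus_iterate_eq_integerHull_of_iso e.symm hr)⟩, ?_⟩
  rw [← Fintype.card_congr e.toEquiv, hG.2]

theorem isLMinimal_aGraphS (n : ℕ) (hS : S ⊆ Finset.Icc 4 (n + 3)) :
    IsLMinimal (n + 1) (aGraphS (n + 3) S) := by
  have hcard : Fintype.card (Finset.Icc 4 (n + 3)) = n := by simp
  refine isLMinimal_of_not_subset ?_ fun hsub => ?_
  · rw [Fintype.card_sum, Fintype.card_prod, hcard]
    simp
    ring
  -- The graph lies between A_k and the graph with all extra edges: the violating point comes from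
  -- the latter, the violated inequality from the former.
  · obtain ⟨x, hx, hlt⟩ := exists_mem_lsPlus_iterate_aGraphS_full (n + 3)
    rw [hcard] at hx
    have hle : aGraphS (n + 3) S ≤ aGraphS (n + 3) (Finset.Icc 4 (n + 3)) := by
      refine sup_le_sup_left ?_ _
      have : ∀ v w, aExtraEdge (n + 3) S v w → aExtraEdge (n + 3) (Finset.Icc 4 (n + 3)) v w := by
        rintro (v | ⟨i, s⟩) (w | w) h
        · exact h
        · exact h
        · exact ⟨hS h.1, h.2⟩
        · exact h
      exact fun v w hvw => ⟨hvw.1, hvw.2.imp (this v w) (this w v)⟩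
    have h1 := hsub (lsPlus_iterate_mono (fracPolytope_anti hle) n hx)
    have h2 : x ∈ integerHull (fracPolytope (aGraph (n + 3))) :=
      convexHull_mono (Set.inter_subset_inter_left _ (fracPolytope_anti le_sup_left)) h1
    exact absurd (sum_le_of_mem_integerHull_aGraph h2) (not_le.2 hlt)

open Classical in
theorem degreeMultiset_eq_of_iso {V W : Type*} [Fintype V] [Fintype W] {G : SimpleGraph V}
    {H : SimpleGraph W} (e : G ≃g H) : degreeMultiset G = degreeMultiset H := by
  unfold degreeMultiset
  have : (Finset.univ : Finset W).val = (Finset.univ : Finset V).val.map e := by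
    rw [← Finset.map_univ_equiv e.toEquiv]
    rfl
  rw [this, Multiset.map_map]
  refine Multiset.map_congr rfl fun v _ => ?_
  exact (e.degree_eq v).symm

theorem aGraphS_adj_of_forall_ne {S S' : Finset ℕ} {v : AVertex k} (h2 : v ≠ tri2 k)
    (h : ∀ i, v ≠ .inr (i, 2)) (w : AVertex k) :
    (aGraphS k S).Adj v w ↔ (aGraphS k S').Adj v w := by
  revert v w
  simp only [aGraphS, SimpleGraph.sup_adj, SimpleGraph.fromRel_adj]
  intro v h2 h w
  have : ∀ S, ¬ (aExtraEdge k S v w ∨ aExtraEdge k S w v) := by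
    intro S
    rcases v with v | ⟨i, s⟩ <;> rcases w with w | ⟨j, t⟩ <;> simp only [aExtraEdge, not_or, not_and]
    · simp
    · refine ⟨fun h => h, fun _ _ hv => h2 ?_⟩
      simp [Subtype.ext_iff, hv]
    · refine ⟨fun _ hs => absurd (by rw [hs]) (h i), fun h => h⟩
    · simp
  simp [this]

/-- The neighbors of `i₂` in `A_{k,S}`. -/
theorem aGraphS_adj_node_two {i : Finset.Icc 4 k} {w : AVertex k} :
    (aGraphS k S).Adj (.inr (i, 2)) w ↔ ((i : ℕ) ∈ S ∧ w = tri2 k) ∨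
      w = .inr (i, 0) ∨ w = tri1 k ∨ ∃ j, i < j ∧ .inr (j, 1) = w := by
  revert w
  rw [forall_aVertex]
  refine ⟨?_, ?_, ?_, fun j => ⟨?_, ?_, ?_⟩⟩ <;>
    simp [aGraphS, aGraph, aEdge, aExtraEdge, eq_comm]

theorem card_filter_lt_Icc (i : Finset.Icc 4 k) :
    (Finset.univ.filter fun j : Finset.Icc 4 k => i < j).card = k - i := by
  have hi := Finset.mem_Icc.1 i.2
  rw [← Nat.card_Ioc, ← Finset.card_map (Function.Embedding.subtype _)]
  congr 1
  ext j
  simp only [Finset.mem_map, Finset.mem_filter, Finset.mem_univ, true_and, Finset.mem_Ioc]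
  constructor
  · rintro ⟨j, hj, rfl⟩
    exact ⟨hj, (Finset.mem_Icc.1 j.2).2⟩
  · rintro ⟨h1, h2⟩
    exact ⟨⟨j, Finset.mem_Icc.2 ⟨by omega, h2⟩⟩, h1, rfl⟩

/-- The embedding `i ↦ i₁`. -/
def nodeOne (k : ℕ) : Finset.Icc 4 k ↪ AVertex k :=
  ⟨fun i => .inr (i, 1), fun i j h => by simpa using h⟩

@[simp] theorem nodeOne_apply (i : Finset.Icc 4 k) : nodeOne k i = .inr (i, 1) := rfl

open Classical in
theorem degree_aGraphS_node_two (i : Finset.Icc 4 k) :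
    (aGraphS k S).degree (.inr (i, 2)) = k - i + 2 + if (i : ℕ) ∈ S then 1 else 0 := by
  have : (aGraphS k S).neighborFinset (.inr (i, 2)) = (if (i : ℕ) ∈ S then {tri2 k} else ∅) ∪
      insert (.inr (i, 0)) (insert (tri1 k)
        ((Finset.univ.filter fun j => i < j).map (nodeOne k))) := by
    ext w
    rw [SimpleGraph.mem_neighborFinset, aGraphS_adj_node_two]
    have h1 : w ∈ (if (i : ℕ) ∈ S then ({tri2 k} : Finset (AVertex k)) else ∅) ↔
        (i : ℕ) ∈ S ∧ w = tri2 k := by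
      split_ifs with h <;> simp [h]
    simp only [Finset.mem_union, h1, Finset.mem_insert, Finset.mem_map, Finset.mem_filter,
      Finset.mem_univ, true_and, nodeOne_apply]
  rw [← SimpleGraph.card_neighborFinset_eq_degree, this, Finset.card_union_of_disjoint,
    Finset.card_insert_of_notMem, Finset.card_insert_of_notMem, Finset.card_map,
    card_filter_lt_Icc]
  · split_ifs <;> simp; ring
  · simp
  · simp
  · split_ifs <;> simp

open Classical in
-- The degree of vertex 2 varies with S, but this bound, from 1, 3 and all i₁, puts it above every
-- threshold k + 3 - i with i ≥ 4.
theorem le_degree_aGraphS_tri2 (hk : 3 ≤ k) : k - 1 ≤ (aGraphS k S).degree (tri2 k) := by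
  have hsub : insert (tri1 k) (insert (tri3 k) (Finset.univ.map (nodeOne k))) ⊆
      (aGraphS k S).neighborFinset (tri2 k) := by
    intro w hw
    rw [SimpleGraph.mem_neighborFinset]
    simp only [Finset.mem_insert, Finset.mem_map, Finset.mem_univ, true_and] at hw
    refine Or.inl ?_
    rcases hw with rfl | rfl | ⟨i, rfl⟩ <;> simp [aGraph, aEdge]
  have := Finset.card_le_card hsub
  rw [Finset.card_insert_of_notMem (by simp),
    Finset.card_insert_of_notMem (by simp), Finset.card_map, Finset.card_univ,
    SimpleGraph.card_neighborFinset_eq_degree, Fintype.card_coe, Nat.card_Icc] at this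
  omega

open Classical in
theorem degreeMultiset_aGraphS_ne (hS : S ⊆ Finset.Icc 4 k) {i : ℕ} (hi : i ∈ S) (hi' : i ∉ S') :
    degreeMultiset (aGraphS k S) ≠ degreeMultiset (aGraphS k S') := by
  intro heq
  have hik := Finset.mem_Icc.1 (hS hi)
  -- The threshold k + 3 - i separates the two possible degrees of i₂. For j < i both possible
  -- degrees of j₂ reach it, for j > i neither does, vertex 2 always does, and all other degrees are
  -- independent of S. So only i₂ changes the count.
  have hcount := congrArg (Multiset.countP (k + 3 - i ≤ ·)) heq
  simp only [degreeMultiset, Multiset.countP_map] at hcount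
  set v : AVertex k := .inr (⟨i, hS hi⟩, 2) with hv
  have hv1 : (aGraphS k S).degree v = k + 3 - i := by
    rw [degree_aGraphS_node_two, if_pos hi]
    change k - i + 2 + 1 = _
    omega
  have hv2 : (aGraphS k S').degree v = k + 2 - i := by
    rw [degree_aGraphS_node_two, if_neg hi']
    change k - i + 2 + 0 = _
    omega
  have hsame : ∀ w, w ≠ v →
      (k + 3 - i ≤ (aGraphS k S).degree w ↔ k + 3 - i ≤ (aGraphS k S').degree w) := by
    intro w hw
    by_cases h2 : w = tri2 k
    · subst h2
      have h1 := le_degree_aGraphS_tri2 (S := S) (k := k) (by omega)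
      have h2 := le_degree_aGraphS_tri2 (S := S') (k := k) (by omega)
      constructor <;> intro <;> omega
    · by_cases h3 : ∃ j, w = .inr (j, 2)
      · obtain ⟨j, rfl⟩ := h3
        have hji : (j : ℕ) ≠ i := by
          rintro rfl
          exact hw rfl
        have := Finset.mem_Icc.1 j.2
        rw [degree_aGraphS_node_two, degree_aGraphS_node_two]
        split_ifs <;> omega
      · push Not at h3
        have : (aGraphS k S).degree w = (aGraphS k S').degree w := by
          rw [← SimpleGraph.card_neighborFinset_eq_degree,
            ← SimpleGraph.card_neighborFinset_eq_degree]
          congr 1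
          ext u
          simpa using aGraphS_adj_of_forall_ne h2 h3 u
        rw [this]
  have hlt : (Finset.univ.filter fun w => k + 3 - i ≤ (aGraphS k S').degree w) ⊂
      Finset.univ.filter fun w => k + 3 - i ≤ (aGraphS k S).degree w := by
    refine Finset.ssubset_iff_subset_ne.2 ⟨fun w => ?_, fun h => ?_⟩
    · simp only [Finset.mem_filter, Finset.mem_univ, true_and]
      by_cases hw : w = v
      · rw [hw, hv1, hv2]
        omega
      · exact (hsame w hw).2
    · have := Finset.ext_iff.1 h v
      simp only [Finset.mem_filter, Finset.mem_univ, true_and, hv1, hv2] at this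
      omega
  exact (Finset.card_lt_card hlt).ne' hcount

end AGraphDegree

theorem theorem5p4 (ℓ : ℕ) (hℓ : 1 ≤ ℓ) :
    (∃ 𝒢 : Finset (SimpleGraph (Fin (3 * ℓ))),
      2 ^ (ℓ - 1) ≤ 𝒢.card ∧
      (∀ G ∈ 𝒢, IsLMinimal ℓ G) ∧
      (∀ G ∈ 𝒢, ∀ H ∈ 𝒢, G ≠ H → IsEmpty (G ≃g H))) ∧
    (∀ S : Finset ℕ, S ⊆ Finset.Icc 4 (ℓ + 2) → IsLMinimal ℓ (aGraphS (ℓ + 2) S)) ∧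
    (∀ S S' : Finset ℕ, S ⊆ Finset.Icc 4 (ℓ + 2) → S' ⊆ Finset.Icc 4 (ℓ + 2) → S ≠ S' →
      degreeMultiset (aGraphS (ℓ + 2) S) ≠ degreeMultiset (aGraphS (ℓ + 2) S') ∧
      IsEmpty (aGraphS (ℓ + 2) S ≃g aGraphS (ℓ + 2) S')) := by
  classical
  obtain ⟨n, rfl⟩ : ∃ n, ℓ = n + 1 := ⟨ℓ - 1, by omega⟩
  have hmin : ∀ S : Finset ℕ, S ⊆ Finset.Icc 4 (n + 1 + 2) →
      IsLMinimal (n + 1) (aGraphS (n + 1 + 2) S) := fun S hS => isLMinimal_aGraphS n hS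
  have hdeg : ∀ S S' : Finset ℕ, S ⊆ Finset.Icc 4 (n + 1 + 2) → S' ⊆ Finset.Icc 4 (n + 1 + 2) →
      S ≠ S' → degreeMultiset (aGraphS (n + 1 + 2) S) ≠
        degreeMultiset (aGraphS (n + 1 + 2) S') := by
    intro S S' hS hS' hne
    by_cases hsub : S ⊆ S'
    · obtain ⟨i, hi', hi⟩ := Finset.not_subset.1 fun h => hne (hsub.antisymm h)
      exact (degreeMultiset_aGraphS_ne hS' hi' hi).symm
    · obtain ⟨i, hi, hi'⟩ := Finset.not_subset.1 hsub
      exact degreeMultiset_aGraphS_ne hS hi hi'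
  refine ⟨?_, hmin, fun S S' hS hS' hne => ⟨hdeg S S' hS hS' hne,
    ⟨fun e => hdeg S S' hS hS' hne (degreeMultiset_eq_of_iso e)⟩⟩⟩
  have e : AVertex (n + 1 + 2) ≃ Fin (3 * (n + 1)) :=
    Fintype.equivFinOfCardEq (hmin ∅ (Finset.empty_subset _)).2
  have he : ∀ S, aGraphS (n + 1 + 2) S ≃g (aGraphS (n + 1 + 2) S).map e.toEmbedding :=
    fun S => SimpleGraph.Iso.map e _
  have hinj : Set.InjOn (fun S => (aGraphS (n + 1 + 2) S).map e.toEmbedding)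
      ((Finset.Icc 4 (n + 1 + 2)).powerset : Set (Finset ℕ)) := by
    intro S hS S' hS' heq
    by_contra hne
    refine hdeg S S' (Finset.mem_powerset.1 hS) (Finset.mem_powerset.1 hS') hne ?_
    have heq' : (aGraphS (n + 1 + 2) S).map e.toEmbedding =
      (aGraphS (n + 1 + 2) S').map e.toEmbedding := heq
    rw [degreeMultiset_eq_of_iso (he S), heq', ← degreeMultiset_eq_of_iso (he S')]
  refine ⟨(Finset.Icc 4 (n + 1 + 2)).powerset.image fun S =>
    (aGraphS (n + 1 + 2) S).map e.toEmbedding, ?_, fun G hG => ?_, fun G hG H hH hne => ⟨fun f => ?_⟩⟩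
  · rw [Finset.card_image_of_injOn hinj, Finset.card_powerset, Nat.card_Icc]
    exact Nat.pow_le_pow_right two_pos (by omega)
  · obtain ⟨S, hS, rfl⟩ := Finset.mem_image.1 hG
    exact (hmin S (Finset.mem_powerset.1 hS)).iso (he S)
  · obtain ⟨S, hS, rfl⟩ := Finset.mem_image.1 hG
    obtain ⟨S', hS', rfl⟩ := Finset.mem_image.1 hH
    have hne' : S ≠ S' := fun h => hne (by rw [h])
    refine hdeg S S' (Finset.mem_powerset.1 hS) (Finset.mem_powerset.1 hS') hne' ?_
    rw [degreeMultiset_eq_of_iso (he S), degreeMultiset_eq_of_iso f,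
      ← degreeMultiset_eq_of_iso (he S')]
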